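/- For an element $a$ and an integer $n\ge 0$ write $(a;q)_n:=\prod_{k=0}^{n-1}(1-aq^k)$ (so $(a;q)_0=1$). Let $$\phi(q):=\sum_{n=0}^{\infty}\frac{(-q;q)_{2n}\,q^{n+1}}{(q;q^2)_{n+1}^2},$$ regarded as a formal power series in $q$ with integer coefficients, and let $a(n)$ be its coefficients, $\sum_{n=1}^{\infty}a(n)q^n:=\phi(q)$. Then for every integer $n\ge 0$, $$a(50n+19)\equiv a(50n+39)\equiv a(50n+49)\equiv 0\pmod{25}.$$ -/

import Mathlib

/-- The `q`-shifted factorial `(a; q)_n = ∏_{k=0}^{n-1} (1 - a q^k)`. -/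
def qShifted {R : Type*} [CommRing R] (a q : R) (n : ℕ) : R :=
  ∏ k ∈ Finset.range n, (1 - a * q ^ k)

/-- The denominator `(q; q²)_{n+1}²` of the `n`-th summand of `φ(q)`, in `ℤ⟦q⟧`. -/
noncomputable def phiDenom (n : ℕ) : PowerSeries ℤ :=
  qShifted (PowerSeries.X : PowerSeries ℤ) (PowerSeries.X ^ 2) (n + 1) ^ 2

/-- The `n`-th summand `(-q; q)_{2n} q^{n+1} / (q; q²)_{n+1}²` of `φ(q)`, in `ℤ⟦q⟧`.
The denominator has constant coefficient `1`, so it is invertible in `ℤ⟦q⟧`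
(see `phiDenom_mul_invOfUnit`). -/
noncomputable def phiTerm (n : ℕ) : PowerSeries ℤ :=
  qShifted (-PowerSeries.X : PowerSeries ℤ) PowerSeries.X (2 * n) * PowerSeries.X ^ (n + 1) *
    PowerSeries.invOfUnit (phiDenom n) 1

theorem phiDenom_mul_invOfUnit (n : ℕ) :
    phiDenom n * PowerSeries.invOfUnit (phiDenom n) 1 = 1 := by
  apply PowerSeries.mul_invOfUnit
  simp [phiDenom, qShifted, map_prod]

theorem coeff_phiTerm_of_le {m n : ℕ} (h : m ≤ n) : PowerSeries.coeff m (phiTerm n) = 0 := by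
  have h2 : phiTerm n = PowerSeries.X ^ (n + 1) *
      (qShifted (-PowerSeries.X : PowerSeries ℤ) PowerSeries.X (2 * n) *
        PowerSeries.invOfUnit (phiDenom n) 1) := by
    unfold phiTerm; ring
  rw [h2, PowerSeries.coeff_X_pow_mul', if_neg (by omega)]

open scoped PowerSeries.WithPiTopology in
/-- Ramanujan's function `φ(q) = ∑_{n ≥ 0} (-q; q)_{2n} q^{n+1} / (q; q²)_{n+1}²` as a formal
power series: the sum is taken in the `q`-adic (coefficientwise) topology of `ℤ⟦q⟧`, in which the
series converges (see `hasSum_ramanujanPhi`). -/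
noncomputable def ramanujanPhi : PowerSeries ℤ := ∑' n : ℕ, phiTerm n

open scoped PowerSeries.WithPiTopology in
theorem hasSum_ramanujanPhi : HasSum phiTerm ramanujanPhi := by
  apply Summable.hasSum
  rw [PowerSeries.WithPiTopology.summable_iff_summable_coeff]
  intro m
  apply summable_of_ne_finset_zero (s := Finset.range m)
  intro n hn
  exact coeff_phiTerm_of_le (by simpa using hn)

/-- The coefficient `a(n)` of `q^n` in `φ(q)`. -/
noncomputable def phiCoeff (n : ℕ) : ℤ := PowerSeries.coeff n ramanujanPhi

theorem phiCoeff_eq_sum (m : ℕ) :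
    phiCoeff m = ∑ n ∈ Finset.range m, PowerSeries.coeff m (phiTerm n) := by
  have h := (PowerSeries.WithPiTopology.hasSum_iff_hasSum_coeff ℤ).1 hasSum_ramanujanPhi m
  refine h.unique (hasSum_sum_of_ne_finset_zero ?_)
  intro n hn
  exact coeff_phiTerm_of_le (by simpa using hn)

/-! Write J₁ = (q; q)_∞, J₂ = (q²; q²)_∞. The odd part of φ is an eta quotient: ∑ a(2n+1) qⁿ =
J₂⁸/J₁⁷ (`phiCoeff_two_mul_add_one`). Expanding (q; q²)_{n+1}⁻² in partial fractions and summing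
over n by a q-Gauss sum gives φ = q (J₂/J₁²) ∑ (-1)^r q^{r(r+2)}/(1 - q^{2r+1})
(`ramanujanPhi_eqMod`). A second partial fraction expansion, with poles at ±q^{2r+1}, shows that a
suitable multiple of this Appell–Lerch sum has an infinite product as its even part
(`ramanujanPhi_sub_evalNeg`).

Since 10m+9 = 2(5m+4)+1, the coefficients of F = J₂⁸/J₁⁷ at 5m+4 are needed modulo 25. Write J₁⁵ =
J₁(q⁵)(1 - 5S), S₂ = S(q²), G = J₁³J₂³. Then F J₁(q⁵)² ≡ J₂(q⁵)(G + 5G(2S - S₂)) mod 25. Jacobi's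
identity for J₁³ makes the coefficients of G at 5n+4 vanish mod 25, while those of G(2S - S₂) form
J₁⁷J₂⁷ mod 5 (`coeff_redFive_mul`). Hence ∑ F_{5m+4} q^m ≡ 5 J₁⁵J₂⁸ mod 25 (`exists_sectFour_eq`).
Modulo 5, J₁⁵J₂⁸ is J₁(q⁵)J₂(q⁵)J₂³, which by Jacobi again lives on exponents 0, 2 mod 5; the
classes m = 1, 3, 4 mod 5 are the three progressions.

The congruence for G(2S - S₂) is proved with θ = q d/dq over 𝔽₅. The logarithmic derivatives of J₁
and J₂, and θS, are polynomials in one series E with θE = 1 - E⁴ (`logA_eq`, `logB_eq`,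
`theta_modE`). As 1 - θ⁴ extracts the exponents divisible by 5, the claim becomes a polynomial
identity in E. -/

open PowerSeries Finset

/-! ### Congruences of power series modulo powers of `X`. -/

/-- `f` and `g` agree up to (and excluding) the coefficient of `X ^ M`. -/
def EqMod (M : ℕ) (f g : ℤ⟦X⟧) : Prop := (X : ℤ⟦X⟧) ^ M ∣ f - g

namespace EqMod

variable {M N : ℕ} {f g h f' g' : ℤ⟦X⟧}

theorem refl (M : ℕ) (f : ℤ⟦X⟧) : EqMod M f f := by simp [EqMod]

theorem of_eq (h : f = g) : EqMod M f g := h ▸ refl M f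

theorem symm (h : EqMod M f g) : EqMod M g f := by
  unfold EqMod at *; rw [← neg_sub]; exact (dvd_neg).2 h

theorem trans (h₁ : EqMod M f g) (h₂ : EqMod M g h) : EqMod M f h := by
  have := dvd_add h₁ h₂
  simpa [EqMod] using this

theorem mono (hNM : N ≤ M) (h : EqMod M f g) : EqMod N f g := (pow_dvd_pow _ hNM).trans h

theorem add (h₁ : EqMod M f g) (h₂ : EqMod M f' g') : EqMod M (f + f') (g + g') := by
  have := dvd_add h₁ h₂
  unfold EqMod; convert this using 1; ring

theorem sub (h₁ : EqMod M f g) (h₂ : EqMod M f' g') : EqMod M (f - f') (g - g') := by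
  have := dvd_sub h₁ h₂
  unfold EqMod; convert this using 1; ring

theorem mul (h₁ : EqMod M f g) (h₂ : EqMod M f' g') : EqMod M (f * f') (g * g') := by
  have := dvd_add (h₁.mul_right f') (h₂.mul_left g)
  unfold EqMod; convert this using 1; ring

theorem pow (h₁ : EqMod M f g) (n : ℕ) : EqMod M (f ^ n) (g ^ n) := by
  induction n with
  | zero => simpa using refl M 1
  | succ n ih => rw [pow_succ, pow_succ]; exact ih.mul h₁

theorem sum {ι : Type*} {s : Finset ι} {F G : ι → ℤ⟦X⟧} (h : ∀ i ∈ s, EqMod M (F i) (G i)) :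
    EqMod M (∑ i ∈ s, F i) (∑ i ∈ s, G i) := by
  unfold EqMod
  rw [← Finset.sum_sub_distrib]
  exact Finset.dvd_sum h

theorem X_pow_mul (k : ℕ) (h : EqMod M f g) : EqMod (k + M) (X ^ k * f) (X ^ k * g) := by
  unfold EqMod
  rw [← mul_sub, pow_add]
  exact mul_dvd_mul_left _ h

theorem of_X_pow_mul (k : ℕ) (h : EqMod (k + M) (X ^ k * f) (X ^ k * g)) : EqMod M f g := by
  unfold EqMod at h
  rw [← mul_sub, pow_add] at h
  exact (mul_dvd_mul_iff_left (pow_ne_zero k X_ne_zero)).1 h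

theorem coeff_eq (h : EqMod M f g) {n : ℕ} (hn : n < M) : coeff n f = coeff n g := by
  have := (X_pow_dvd_iff.1 h) n hn
  rw [map_sub] at this
  linarith

theorem of_coeff (h : ∀ n < M, coeff n f = coeff n g) : EqMod M f g :=
  X_pow_dvd_iff.2 fun n hn => by rw [map_sub, h n hn, sub_self]

theorem eq (h : ∀ M, EqMod M f g) : f = g := by
  ext n
  exact (h (n + 1)).coeff_eq (Nat.lt_succ_self n)

theorem expand (p : ℕ) (hp : p ≠ 0) (h : EqMod M f g) :
    EqMod (p * M) (expand p hp f) (PowerSeries.expand p hp g) := by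
  obtain ⟨c, hc⟩ := h
  refine ⟨PowerSeries.expand p hp c, ?_⟩
  rw [← map_sub, hc, map_mul, map_pow, expand_X, pow_mul]

end EqMod

/-! ### Inverses and truncated Euler products. -/

/-- The inverse of a power series with constant coefficient `1`. -/
noncomputable def iv (f : ℤ⟦X⟧) : ℤ⟦X⟧ := invOfUnit f 1

theorem mul_iv {f : ℤ⟦X⟧} (h : constantCoeff f = 1) : f * iv f = 1 :=
  mul_invOfUnit f 1 (by simpa using h)

@[simp] theorem constantCoeff_iv (f : ℤ⟦X⟧) : constantCoeff (iv f) = 1 := by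
  simp [iv, constantCoeff_invOfUnit]

theorem iv_eq_of_mul_eq_one {f g : ℤ⟦X⟧} (h : constantCoeff f = 1) (hfg : f * g = 1) :
    iv f = g := by
  have h1 := mul_iv h
  calc iv f = iv f * (f * g) := by rw [hfg, mul_one]
    _ = (f * iv f) * g := by ring
    _ = g := by rw [h1, one_mul]

theorem EqMod.iv {M : ℕ} {f g : ℤ⟦X⟧} (hf : constantCoeff f = 1) (hg : constantCoeff g = 1)
    (h : EqMod M f g) : EqMod M (iv f) (iv g) := by
  have h1 := mul_iv hf
  have h2 := mul_iv hg
  have h3 := (h.symm).mul (EqMod.refl M (_root_.iv f * _root_.iv g))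
  refine (EqMod.of_eq ?_).trans (h3.trans (EqMod.of_eq ?_))
  · linear_combination (-_root_.iv f) * h2
  · linear_combination (_root_.iv g) * h1

theorem map_iv {φ : ℤ⟦X⟧ →+* ℤ⟦X⟧} {f : ℤ⟦X⟧} (hf : constantCoeff f = 1)
    (hφ : constantCoeff (φ f) = 1) : φ (iv f) = iv (φ f) := by
  refine (iv_eq_of_mul_eq_one hφ ?_).symm
  rw [← map_mul, mul_iv hf, map_one]

/-- `(q; q)_∞`. -/
noncomputable def eulerJ : ℤ⟦X⟧ := pentagonalSeries ℤ

/-- `(q^m; q^m)_∞`. -/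
noncomputable def eulerJE (m : ℕ) (hm : m ≠ 0) : ℤ⟦X⟧ := expand m hm eulerJ

theorem prod_one_sub_eqMod {n : ℕ} (s : Finset ℕ) (hs : range n ⊆ s) :
    EqMod (n + 1) (∏ i ∈ s, (1 - X ^ (i + 1) : ℤ⟦X⟧)) (∏ i ∈ range n, (1 - X ^ (i + 1))) := by
  rw [← Finset.prod_sdiff hs]
  have : EqMod (n + 1) (∏ i ∈ s \ range n, (1 - X ^ (i + 1) : ℤ⟦X⟧)) 1 := by
    have key : ∀ t : Finset ℕ, (∀ i ∈ t, n ≤ i) →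
        EqMod (n + 1) (∏ i ∈ t, (1 - X ^ (i + 1) : ℤ⟦X⟧)) 1 := by
      intro t
      induction t using Finset.induction_on with
      | empty => intro _; simpa using EqMod.refl _ _
      | insert a t ha ih =>
        intro ht
        rw [Finset.prod_insert ha]
        have h1 : EqMod (n + 1) (1 - X ^ (a + 1) : ℤ⟦X⟧) 1 := by
          have : n ≤ a := ht a (by simp)
          unfold EqMod
          rw [sub_sub_cancel_left, dvd_neg]
          exact pow_dvd_pow _ (by omega)
        simpa using h1.mul (ih fun i hi => ht i (by simp [hi]))
    apply key
    intro i hi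
    simp at hi
    exact hi.2
  simpa using this.mul (EqMod.refl _ _)

theorem qShifted_X_X (n : ℕ) :
    qShifted (X : ℤ⟦X⟧) X n = ∏ i ∈ range n, (1 - X ^ (i + 1)) := by
  unfold qShifted
  exact Finset.prod_congr rfl fun i _ => by rw [pow_succ']

/-- Euler's pentagonal number theorem enters here: each coefficient of the finite products is
eventually that of the pentagonal series, and factors beyond the n-th do not touch exponents up to
n. -/
theorem qShifted_eqMod_eulerJ (n : ℕ) : EqMod (n + 1) (qShifted (X : ℤ⟦X⟧) X n) eulerJ := by
  apply EqMod.of_coeff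
  intro k hk
  obtain ⟨s, hs⟩ := (coeff_prod_one_sub_X_pow_eventually_eq ℤ k).exists_forall_of_atTop
  have h1 := hs (s ∪ range n) (by simp)
  rw [qShifted_X_X, eulerJ, ← h1]
  exact ((prod_one_sub_eqMod (s ∪ range n) (by simp)).coeff_eq hk).symm

theorem map_qShifted {R S : Type*} [CommRing R] [CommRing S] (φ : R →+* S) (a q : R) (n : ℕ) :
    φ (qShifted a q n) = qShifted (φ a) (φ q) n := by
  simp [qShifted, map_prod]

theorem qShifted_expand_eqMod (m : ℕ) (hm : m ≠ 0) (n : ℕ) :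
    EqMod (m * (n + 1)) (qShifted (X ^ m : ℤ⟦X⟧) (X ^ m) n) (eulerJE m hm) := by
  have := (qShifted_eqMod_eulerJ n).expand m hm
  have h2 := map_qShifted (expand m hm : ℤ⟦X⟧ →ₐ[ℤ] ℤ⟦X⟧).toRingHom X X n
  simp only [AlgHom.toRingHom_eq_coe, RingHom.coe_coe, expand_X] at h2
  rwa [h2] at this

theorem constantCoeff_qShifted {a q : ℤ⟦X⟧} (ha : constantCoeff a = 0) (n : ℕ) :
    constantCoeff (qShifted a q n) = 1 := by
  simp [qShifted, map_prod, ha]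

@[simp] theorem constantCoeff_eulerJ : constantCoeff eulerJ = 1 := by
  have := (qShifted_eqMod_eulerJ 0).coeff_eq (n := 0) (by norm_num)
  simpa [qShifted] using this.symm

@[simp] theorem constantCoeff_eulerJE (m : ℕ) (hm : m ≠ 0) :
    constantCoeff (eulerJE m hm) = 1 := by
  rw [eulerJE, constantCoeff_expand, constantCoeff_eulerJ]

theorem qShifted_succ {R : Type*} [CommRing R] (a q : R) (n : ℕ) :
    qShifted a q (n + 1) = qShifted a q n * (1 - a * q ^ n) := by
  simp [qShifted, Finset.prod_range_succ]

@[simp] theorem qShifted_zero {R : Type*} [CommRing R] (a q : R) : qShifted a q 0 = 1 := by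
  simp [qShifted]

/-- `(q²; q²)_∞`. -/
noncomputable abbrev eulerJ2 : ℤ⟦X⟧ := eulerJE 2 two_ne_zero

/-- `(q⁴; q⁴)_∞`. -/
noncomputable abbrev eulerJ4 : ℤ⟦X⟧ := eulerJE 4 four_ne_zero

/-- `(q²; q²)_n⁻¹`. -/
noncomputable def ivQ2 (n : ℕ) : ℤ⟦X⟧ := iv (qShifted (X ^ 2) (X ^ 2) n)

theorem ivQ2_succ (n : ℕ) : ivQ2 (n + 1) * (1 - X ^ (2 * n + 2)) = ivQ2 n := by
  have h : constantCoeff (qShifted (X ^ 2 : ℤ⟦X⟧) (X ^ 2) (n + 1)) = 1 :=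
    constantCoeff_qShifted (by simp) _
  have h' : constantCoeff (qShifted (X ^ 2 : ℤ⟦X⟧) (X ^ 2) n) = 1 :=
    constantCoeff_qShifted (by simp) _
  symm
  apply iv_eq_of_mul_eq_one h'
  have h1 := mul_iv h
  rw [qShifted_succ] at h1
  rw [ivQ2, qShifted_succ]
  have e : (X ^ 2 * (X ^ 2) ^ n : ℤ⟦X⟧) = X ^ (2 * n + 2) := by ring
  rw [e] at h1 ⊢
  linear_combination h1

theorem ivQ2_zero : ivQ2 0 = 1 := by
  apply iv_eq_of_mul_eq_one <;> simp

theorem ivQ2_eqMod (n : ℕ) : EqMod (2 * (n + 1)) (ivQ2 n) (iv eulerJ2) :=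
  (qShifted_expand_eqMod 2 two_ne_zero n).iv (constantCoeff_qShifted (by simp) _) (by simp)

theorem qShifted_neg_X_mul (n : ℕ) :
    qShifted (-X : ℤ⟦X⟧) X n * qShifted (X : ℤ⟦X⟧) X n = qShifted (X ^ 2) (X ^ 2) n := by
  simp only [qShifted, ← Finset.prod_mul_distrib]
  exact Finset.prod_congr rfl fun i _ => by ring

theorem qShifted_odd_mul_even (n : ℕ) :
    qShifted (X : ℤ⟦X⟧) (X ^ 2) n * qShifted (X ^ 2 : ℤ⟦X⟧) (X ^ 2) n
      = qShifted X X (2 * n) := by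
  induction n with
  | zero => simp
  | succ n ih =>
    rw [show 2 * (n + 1) = 2 * n + 1 + 1 by ring, qShifted_succ, qShifted_succ, qShifted_succ,
      qShifted_succ, ← ih]
    ring

/-- `(-q; q)_n ≡ J₂ / J₁`. -/
theorem qShifted_neg_X_eqMod (n : ℕ) :
    EqMod (n + 1) (qShifted (-X : ℤ⟦X⟧) X n) (eulerJ2 * iv eulerJ) := by
  have h1 : constantCoeff (qShifted (X : ℤ⟦X⟧) X n) = 1 := constantCoeff_qShifted (by simp) _
  have h2 := mul_iv h1
  have h3 : qShifted (-X : ℤ⟦X⟧) X n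
      = qShifted (X ^ 2) (X ^ 2) n * iv (qShifted (X : ℤ⟦X⟧) X n) := by
    rw [← qShifted_neg_X_mul, mul_assoc, h2, mul_one]
  rw [h3]
  exact ((qShifted_expand_eqMod 2 two_ne_zero n).mono (by omega)).mul
    ((qShifted_eqMod_eulerJ n).iv h1 (by simp))

/-- `(q; q²)_n ≡ J₁ / J₂`. -/
theorem qShifted_odd_eqMod (n : ℕ) :
    EqMod (2 * n + 1) (qShifted (X : ℤ⟦X⟧) (X ^ 2) n) (eulerJ * iv eulerJ2) := by
  have h1 : constantCoeff (qShifted (X ^ 2 : ℤ⟦X⟧) (X ^ 2) n) = 1 :=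
    constantCoeff_qShifted (by simp) _
  have h2 := mul_iv h1
  have h3 : qShifted (X : ℤ⟦X⟧) (X ^ 2) n
      = qShifted X X (2 * n) * iv (qShifted (X ^ 2 : ℤ⟦X⟧) (X ^ 2) n) := by
    rw [← qShifted_odd_mul_even, mul_assoc, h2, mul_one]
  rw [h3]
  exact (qShifted_eqMod_eulerJ (2 * n)).mul
    (((qShifted_expand_eqMod 2 two_ne_zero n).mono (by omega)).iv h1 (by simp))

/-! ### The sum over n: Euler's expansion and a q-Gauss sum. -/

/-- Euler's expansion of `(q^{2k+1}; q²)_∞⁻¹`, truncated. -/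
noncomputable def eulerSum (k S : ℕ) : ℤ⟦X⟧ := ∑ s ∈ range S, X ^ ((2 * k + 1) * s) * ivQ2 s

/-- The s-th terms differ by the factor 1 - X^{2s}, which cancels the last factor of (q²; q²)_s and
shifts the index by one. -/
theorem eulerSum_shift (k S : ℕ) :
    eulerSum k (S + 1) - eulerSum (k + 1) (S + 1) = X ^ (2 * k + 1) * eulerSum k S := by
  rw [eulerSum, eulerSum, ← Finset.sum_sub_distrib, Finset.sum_range_succ', eulerSum,
    Finset.mul_sum]
  simp only [mul_zero, pow_zero, sub_self, add_zero]
  refine Finset.sum_congr rfl fun s _ => ?_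
  rw [← ivQ2_succ s]
  ring

theorem eulerSum_step (k S : ℕ) :
    EqMod S ((1 - X ^ (2 * k + 1)) * eulerSum k S) (eulerSum (k + 1) S) := by
  have h1 := eulerSum_shift k S
  have h2 : ∀ k, EqMod S (eulerSum k (S + 1)) (eulerSum k S) := by
    intro k
    unfold EqMod
    rw [eulerSum, eulerSum, Finset.sum_range_succ, add_sub_cancel_left]
    refine (pow_dvd_pow X ?_).trans (dvd_mul_right _ _)
    nlinarith
  have h3 := ((h2 k).sub (EqMod.refl S (X ^ (2 * k + 1) * eulerSum k S)))
  rw [← h1] at h3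
  have h4 := (h3.symm).trans ((EqMod.of_eq (by ring)).trans (h2 (k + 1)))
  exact (EqMod.of_eq (by linear_combination h1)).trans h4

theorem eulerSum_eqMod_one (k S : ℕ) (hS : 0 < S) : EqMod (2 * k + 1) (eulerSum k S) 1 := by
  obtain ⟨S, rfl⟩ := Nat.exists_eq_succ_of_ne_zero hS.ne'
  unfold EqMod
  rw [eulerSum, Finset.sum_range_succ']
  simp only [mul_zero, pow_zero, ivQ2_zero, mul_one, add_sub_cancel_right]
  refine Finset.dvd_sum fun s _ => ?_
  exact (pow_dvd_pow X (by nlinarith)).trans (dvd_mul_right _ _)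

/-- Iterating `eulerSum_step` multiplies by (q; q²)_K and moves k from 0 to K, where the sum is
already 1 to the required precision. -/
theorem eulerSum_zero_eqMod (S : ℕ) : EqMod S (eulerSum 0 S) (eulerJ2 * iv eulerJ) := by
  rcases Nat.eq_zero_or_pos S with rfl | hS
  · simp [EqMod]
  have h1 : ∀ K, EqMod S (qShifted X (X ^ 2) K * eulerSum 0 S) (eulerSum K S) := by
    intro K
    induction K with
    | zero => simpa using EqMod.refl _ _
    | succ K ih =>
      rw [qShifted_succ]
      refine (EqMod.of_eq ?_).trans (((EqMod.refl S (1 - X ^ (2 * K + 1))).mul ih).trans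
        (eulerSum_step K S))
      ring
  have h2 := (h1 S).trans ((eulerSum_eqMod_one S S hS).mono (by omega))
  have h3 := (((qShifted_odd_eqMod S).mono (by omega : S ≤ 2 * S + 1)).mul
    (EqMod.refl S (eulerSum 0 S))).symm.trans h2
  have h4 := (EqMod.refl S (eulerJ2 * iv eulerJ)).mul h3
  refine (EqMod.of_eq ?_).trans (h4.trans (EqMod.of_eq (mul_one _)))
  have e1 : eulerJ * iv eulerJ = 1 := mul_iv (by simp)
  have e2 : eulerJ2 * iv eulerJ2 = 1 := mul_iv (by simp)
  linear_combination (-eulerSum 0 S) * e1 - (eulerSum 0 S) * (eulerJ * iv eulerJ) * e2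

/-- The summand `(-q; q)_{2n} q^{n+1} / ((q²; q²)_{n-r} (q²; q²)_{n+r+1})` with `n = r + s`. -/
noncomputable def baileyTerm (r s : ℕ) : ℤ⟦X⟧ :=
  qShifted (-X) X (2 * (r + s)) * X ^ (r + s + 1) * ivQ2 s * ivQ2 (2 * r + s + 1)

/-- The partial sums `∑_{r ≤ n < r + S}` of the previous summands. -/
noncomputable def baileySum (r S : ℕ) : ℤ⟦X⟧ := ∑ s ∈ range S, baileyTerm r s

theorem qShifted_neg_X_two_mul_succ (n : ℕ) :
    qShifted (-X : ℤ⟦X⟧) X (2 * (n + 1))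
      = qShifted (-X) X (2 * n) * ((1 + X ^ (2 * n + 1)) * (1 + X ^ (2 * n + 2))) := by
  rw [show 2 * (n + 1) = 2 * n + 1 + 1 by ring, qShifted_succ, qShifted_succ]
  ring

/-- A telescoping certificate: the increment of the right side in S is the difference of the new
summands on the left. The factor X^{r+S+2} makes the right side negligible, so in the limit (1 +
q^{2r+1}) times the sum just gains a factor q when r grows by one. -/
theorem baileySum_telescope (r S : ℕ) :
    X * (1 + X ^ (2 * r + 1)) * baileySum r (S + 1)
        - (1 + X ^ (2 * r + 3)) * baileySum (r + 1) S
      = (1 - X ^ (2 * r + 2)) * qShifted (-X) X (2 * (r + S + 1)) * X ^ (r + S + 2)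
        * ivQ2 S * ivQ2 (2 * r + S + 2) := by
  induction S with
  | zero =>
    simp only [baileySum, baileyTerm, zero_add, Finset.sum_range_one, Finset.sum_range_zero,
      ivQ2_zero, add_zero]
    rw [qShifted_neg_X_two_mul_succ, ← ivQ2_succ (2 * r + 1)]
    ring
  | succ S ih =>
    have h1 : baileySum r (S + 1 + 1) = baileySum r (S + 1) + baileyTerm r (S + 1) :=
      Finset.sum_range_succ _ _
    have h2 : baileySum (r + 1) (S + 1) = baileySum (r + 1) S + baileyTerm (r + 1) S :=
      Finset.sum_range_succ _ _
    have e1 : baileyTerm r (S + 1) = qShifted (-X) X (2 * (r + S + 1)) * X ^ (r + S + 2)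
        * ivQ2 (S + 1) * ivQ2 (2 * r + S + 2) := by
      unfold baileyTerm
      congr 2
    have e2 : baileyTerm (r + 1) S = qShifted (-X) X (2 * (r + S + 1)) * X ^ (r + S + 2)
        * ivQ2 S * ivQ2 (2 * r + S + 3) := by
      unfold baileyTerm
      rw [show r + 1 + S = r + S + 1 by ring, show 2 * (r + 1) + S + 1 = 2 * r + S + 3 by ring]
    rw [h1, h2, e1, e2, show 2 * (r + (S + 1) + 1) = 2 * ((r + S + 1) + 1) by ring,
      qShifted_neg_X_two_mul_succ (r + S + 1), show 2 * r + (S + 1) + 2 = 2 * r + S + 3 by ring]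
    have q1 := ivQ2_succ S
    have q2 : ivQ2 (2 * r + S + 3) * _ = _ := ivQ2_succ (2 * r + S + 2)
    rw [← q1, ← q2] at ih ⊢
    linear_combination ih

theorem baileySum_eqMod_shift (r S : ℕ) :
    EqMod (r + S + 2) (X * ((1 + X ^ (2 * r + 1)) * baileySum r S))
      ((1 + X ^ (2 * (r + 1) + 1)) * baileySum (r + 1) S) := by
  have h1 : EqMod (r + S + 1) (baileySum r (S + 1)) (baileySum r S) := by
    unfold EqMod
    rw [baileySum, baileySum, Finset.sum_range_succ, add_sub_cancel_left, baileyTerm]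
    exact ⟨qShifted (-X) X (2 * (r + S)) * ivQ2 S * ivQ2 (2 * r + S + 1), by ring⟩
  have h2 := ((EqMod.refl _ (1 + X ^ (2 * r + 1))).mul h1).X_pow_mul 1
  rw [show 1 + (r + S + 1) = r + S + 2 by ring, pow_one] at h2
  refine h2.symm.trans ?_
  unfold EqMod
  have := baileySum_telescope r S
  refine ⟨(1 - X ^ (2 * r + 2)) * qShifted (-X) X (2 * (r + S + 1))
        * ivQ2 S * ivQ2 (2 * r + S + 2), ?_⟩
  linear_combination this

theorem baileySum_eqMod_iterate (r k S : ℕ) :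
    EqMod (r + k + S + 1) (X ^ k * ((1 + X ^ (2 * r + 1)) * baileySum r S))
      ((1 + X ^ (2 * (r + k) + 1)) * baileySum (r + k) S) := by
  induction k with
  | zero => simpa using EqMod.refl _ _
  | succ k ih =>
    have h1 := ih.X_pow_mul 1
    have h2 := baileySum_eqMod_shift (r + k) S
    refine (EqMod.of_eq (by ring)).trans ((h1.mono (by omega)).trans ?_)
    rw [pow_one]
    exact h2.mono (by omega)

/-- For k large against S, every factor of a summand except X^s and (q²; q²)_s⁻¹ has reached its
limit, and Euler's expansion sums what remains. -/
theorem baileySum_eqMod_of_large (k S : ℕ) (h : S ≤ 2 * k + 1) :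
    EqMod (k + 1 + S) ((1 + X ^ (2 * k + 1)) * baileySum k S)
      (X ^ (k + 1) * (eulerJ2 * iv eulerJ ^ 2)) := by
  have e : baileySum k S = X ^ (k + 1) * ∑ s ∈ range S,
      qShifted (-X) X (2 * (k + s)) * X ^ s * ivQ2 s * ivQ2 (2 * k + s + 1) := by
    rw [baileySum, Finset.mul_sum]
    exact Finset.sum_congr rfl fun s _ => by rw [baileyTerm]; ring
  rw [e, mul_left_comm]
  apply EqMod.X_pow_mul
  have h1 : EqMod S (1 + X ^ (2 * k + 1) : ℤ⟦X⟧) 1 := by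
    unfold EqMod
    rw [add_sub_cancel_left]
    exact pow_dvd_pow _ h
  have h2 : EqMod S (∑ s ∈ range S,
      qShifted (-X) X (2 * (k + s)) * X ^ s * ivQ2 s * ivQ2 (2 * k + s + 1))
      (∑ s ∈ range S, (eulerJ2 * iv eulerJ) * X ^ s * ivQ2 s * iv eulerJ2) := by
    refine EqMod.sum fun s _ => ?_
    refine (((((qShifted_neg_X_eqMod _).mono ?_).mul (EqMod.refl _ _)).mul (EqMod.refl _ _)).mul
      ((ivQ2_eqMod _).mono ?_)) <;> omega
  have h3 : ∑ s ∈ range S, (eulerJ2 * iv eulerJ) * X ^ s * ivQ2 s * iv eulerJ2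
      = iv eulerJ * eulerSum 0 S := by
    have e2 : eulerJ2 * iv eulerJ2 = 1 := mul_iv (by simp)
    rw [eulerSum, Finset.mul_sum]
    refine Finset.sum_congr rfl fun s _ => ?_
    rw [mul_zero, zero_add, one_mul]
    linear_combination (iv eulerJ * X ^ s * ivQ2 s) * e2
  rw [h3] at h2
  have h4 := h1.mul (h2.trans ((EqMod.refl _ _).mul (eulerSum_zero_eqMod S)))
  exact h4.trans (EqMod.of_eq (by ring))

/-- A case of the `q`-Gauss sum. -/
theorem baileySum_eqMod (r S : ℕ) :
    EqMod (r + 1 + S) ((1 + X ^ (2 * r + 1)) * baileySum r S)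
      (X ^ (r + 1) * (eulerJ2 * iv eulerJ ^ 2)) := by
  -- Moving from r to r + S multiplies by X^S and reaches the range where the sum is known; X^S is
  -- then cancelled.
  apply EqMod.of_X_pow_mul S
  have h1 := baileySum_eqMod_iterate r S S
  have h2 := baileySum_eqMod_of_large (r + S) S (by omega)
  exact ((h1.mono (by omega)).trans (h2.mono (by omega))).trans (EqMod.of_eq (by ring))

/-! ### Partial fractions of (q; q²)_{n+1}⁻². -/

section PartialFractions

variable {K : Type*} [Field K]

/-- Lagrange interpolation at the nodes `d i / e i`, evaluated at `y`. -/
theorem eval_eq_sum_nodes {ι : Type*} [DecidableEq ι] (s : Finset ι) (d e : ι → K)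
    (he : ∀ i ∈ s, e i ≠ 0) (hinj : Set.InjOn (fun i => d i / e i) s) (f : Polynomial K)
    (hf : f.degree < #s) (y : K) :
    f.eval y = ∑ i ∈ s, f.eval (d i / e i) *
      ∏ j ∈ s.erase i, ((d j - e j * y) / (d j - e j * (d i / e i))) := by
  conv_lhs => rw [Lagrange.eq_interpolate hinj hf]
  rw [Lagrange.interpolate_apply, Polynomial.eval_finsetSum]
  refine Finset.sum_congr rfl fun i _ => ?_
  rw [Polynomial.eval_mul, Polynomial.eval_C, Lagrange.basis, Polynomial.eval_prod]
  congr 1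
  refine Finset.prod_congr rfl fun j hj => ?_
  have hj' := he j (Finset.mem_of_mem_erase hj)
  rw [Lagrange.basisDivisor, Polynomial.eval_mul, Polynomial.eval_C, Polynomial.eval_sub,
    Polynomial.eval_X, Polynomial.eval_C]
  have e1 : d j - e j * y = (-e j) * (y - d j / e j) := by field_simp; ring
  have e2 : d j - e j * (d i / e i) = (-e j) * (d i / e i - d j / e j) := by
    field_simp; ring
  rw [e1, e2, mul_div_mul_left _ _ (neg_ne_zero.2 hj'), mul_comm, ← div_eq_mul_inv]

/-- Partial fractions of a polynomial in `x + 1/x` over `∏ (1 - t i x) (1 - t i / x)`, at `x = 1`. -/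
theorem div_prod_eq_sum {ι : Type*} [DecidableEq ι] (s : Finset ι) (t : ι → K)
    (ht : ∀ i ∈ s, t i ≠ 0) (ht1 : ∀ i ∈ s, t i ≠ 1)
    (hinj : ∀ i ∈ s, ∀ j ∈ s, i ≠ j → t i ≠ t j) (hmul : ∀ i ∈ s, ∀ j ∈ s, i ≠ j → t i * t j ≠ 1)
    (f : Polynomial K) (hf : f.degree < #s) :
    f.eval 2 / ∏ i ∈ s, (1 - t i) ^ 2 = ∑ i ∈ s, f.eval (t i + (t i)⁻¹) / ((1 - t i) ^ 2 *
      ∏ j ∈ s.erase i, ((1 - t i * t j) * (1 - t j / t i))) := by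
  have hne : ∀ i ∈ s, (1 - t i) ^ 2 ≠ 0 := fun i hi =>
    pow_ne_zero _ (sub_ne_zero.2 (ht1 i hi).symm)
  have hv : ∀ i ∈ s, (1 + t i ^ 2) / t i = t i + (t i)⁻¹ := by
    intro i hi
    have := ht i hi
    field_simp; ring
  have hinj' : Set.InjOn (fun i => (1 + t i ^ 2) / t i) s := by
    intro i hi j hj hij
    by_contra hne
    have h1 := ht i hi
    have h2 := ht j hj
    simp only at hij
    rw [div_eq_div_iff h1 h2] at hij
    have h3 : (t i - t j) * (t i * t j - 1) = 0 := by linear_combination hij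
    rcases mul_eq_zero.1 h3 with h | h
    · exact hinj i hi j hj hne (sub_eq_zero.1 h)
    · exact hmul i hi j hj hne (sub_eq_zero.1 h)
  -- With y = x + 1/x, (1 - t x)(1 - t/x) = 1 + t² - t y vanishes at y = (1 + t²)/t, and x = 1
  -- corresponds to y = 2.
  rw [eval_eq_sum_nodes s (fun i => 1 + t i ^ 2) t ht hinj' f hf 2, Finset.sum_div]
  refine Finset.sum_congr rfl fun i hi => ?_
  rw [hv i hi, ← Finset.mul_prod_erase s _ hi, Finset.prod_div_distrib]
  have e1 : ∏ j ∈ s.erase i, (1 + t j ^ 2 - t j * 2) = ∏ j ∈ s.erase i, (1 - t j) ^ 2 :=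
    Finset.prod_congr rfl fun j _ => by ring
  have e2 : ∏ j ∈ s.erase i, (1 + t j ^ 2 - t j * (t i + (t i)⁻¹))
      = ∏ j ∈ s.erase i, ((1 - t i * t j) * (1 - t j / t i)) :=
    Finset.prod_congr rfl fun j _ => by
      have := ht i hi
      field_simp; ring
  have h3 : ∏ j ∈ s.erase i, (1 - t j) ^ 2 ≠ 0 :=
    Finset.prod_ne_zero_iff.2 fun j hj => hne j (Finset.mem_of_mem_erase hj)
  have h4 := hne i hi
  rw [e1, e2]
  field_simp

/-- `∏_{j < r} (1 - a q^{2(j - r)})`. -/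
theorem prod_one_sub_neg_pow {q a : K} (hq : q ≠ 0) (ha : a ≠ 0) (r : ℕ) :
    (∏ j ∈ range r, (1 - a * q ^ (2 * j) / q ^ (2 * r))) * q ^ (r * (r + 1))
      = (-a) ^ r * qShifted (a⁻¹ * q ^ 2) (q ^ 2) r := by
  induction r with
  | zero => simp
  | succ r ih =>
    rw [Finset.prod_range_succ', qShifted_succ]
    have e1 : ∏ j ∈ range r, (1 - a * q ^ (2 * (j + 1)) / q ^ (2 * (r + 1)))
        = ∏ j ∈ range r, (1 - a * q ^ (2 * j) / q ^ (2 * r)) :=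
      Finset.prod_congr rfl fun j _ => by
        congr 1
        field_simp
        ring
    rw [e1, show (r + 1) * (r + 1 + 1) = r * (r + 1) + 2 * (r + 1) by ring, pow_add]
    have e2 : (1 - a * q ^ (2 * 0) / q ^ (2 * (r + 1))) * q ^ (2 * (r + 1))
        = -a * (1 - a⁻¹ * q ^ 2 * (q ^ 2) ^ r) := by
      field_simp
      ring
    rw [pow_succ]
    linear_combination ((∏ j ∈ range r, (1 - a * q ^ (2 * j) / q ^ (2 * r))) * q ^ (r * (r + 1)))
      * e2 + (-a * (1 - a⁻¹ * q ^ 2 * (q ^ 2) ^ r)) * ih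

theorem qShifted_add {R : Type*} [CommRing R] (a q : R) (m n : ℕ) :
    qShifted a q (m + n) = qShifted a q m * qShifted (a * q ^ m) q n := by
  simp only [qShifted, Finset.prod_range_add]
  congr 1
  exact Finset.prod_congr rfl fun i _ => by ring

/-- `∏_{j < r + k} (1 - a q^{2(j - r)})`. -/
theorem prod_one_sub_shift_pow {q a : K} (hq : q ≠ 0) (ha : a ≠ 0) (r k : ℕ) :
    (∏ j ∈ range (r + k), (1 - a * q ^ (2 * j) / q ^ (2 * r))) * q ^ (r * (r + 1))
      = (-a) ^ r * qShifted (a⁻¹ * q ^ 2) (q ^ 2) r * qShifted a (q ^ 2) k := by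
  rw [Finset.prod_range_add, ← prod_one_sub_neg_pow hq ha]
  have e1 : ∏ j ∈ range k, (1 - a * q ^ (2 * (r + j)) / q ^ (2 * r)) = qShifted a (q ^ 2) k :=
    Finset.prod_congr rfl fun j _ => by
      rw [← pow_mul, mul_add, pow_add]
      field_simp
  rw [e1]
  ring

/-- The product `∏_{j ≠ r, j < N} (1 - q^{2j+2r+2}) (1 - q^{2(j-r)})`, where `N = r + k + 1`. -/
theorem prod_erase_one_sub {q : K} (hq : q ≠ 0) (r k : ℕ) :
    (∏ j ∈ (range (r + k + 1)).erase r, ((1 - q ^ (2 * r + 1) * q ^ (2 * j + 1)) *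
        (1 - q ^ (2 * j + 1) / q ^ (2 * r + 1)))) * ((1 - q ^ (4 * r + 2)) * q ^ (r * (r + 1)))
      = (-1) ^ r * qShifted (q ^ 2) (q ^ 2) (r + k + 1 + r) * qShifted (q ^ 2) (q ^ 2) k := by
  have hmem : r ∈ range (r + k + 1) := mem_range.2 (by omega)
  rw [Finset.prod_mul_distrib]
  have h1 : (∏ j ∈ (range (r + k + 1)).erase r, (1 - q ^ (2 * r + 1) * q ^ (2 * j + 1)))
      * (1 - q ^ (4 * r + 2)) = qShifted (q ^ 2 * (q ^ 2) ^ r) (q ^ 2) (r + k + 1) := by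
    rw [qShifted, ← Finset.mul_prod_erase _ _ hmem, mul_comm]
    congr 1
    · ring
    · exact Finset.prod_congr rfl fun j _ => by ring
  have h2 : ∏ j ∈ (range (r + k + 1)).erase r, (1 - q ^ (2 * j + 1) / q ^ (2 * r + 1))
      = (∏ j ∈ range r, (1 - 1 * q ^ (2 * j) / q ^ (2 * r))) * qShifted (q ^ 2) (q ^ 2) k := by
    have hs : (range (r + k + 1)).erase r = range r ∪ (range k).map (addLeftEmbedding (r + 1)) := by
      ext x
      simp only [mem_erase, mem_range, mem_union, mem_map, addLeftEmbedding_apply]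
      constructor
      · rintro ⟨h, h'⟩
        by_cases hx : x < r
        · exact Or.inl hx
        · exact Or.inr ⟨x - (r + 1), by omega, by omega⟩
      · rintro (h | ⟨y, hy, rfl⟩) <;> omega
    rw [hs, Finset.prod_union, Finset.prod_map]
    · congr 1
      · exact Finset.prod_congr rfl fun j _ => by field_simp; ring
      · exact Finset.prod_congr rfl fun j _ => by
          congr 1
          rw [addLeftEmbedding_apply, ← pow_mul, ← pow_add, div_eq_iff (pow_ne_zero _ hq),
            ← pow_add]
          congr 1
          ring
    · rw [Finset.disjoint_left]
      intro x hx hx'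
      simp only [mem_range, mem_map, addLeftEmbedding_apply] at hx hx'
      obtain ⟨y, _, rfl⟩ := hx'
      omega
  have h3 := prod_one_sub_neg_pow hq (one_ne_zero : (1 : K) ≠ 0) r
  rw [inv_one, one_mul] at h3
  have h4 : qShifted (q ^ 2) (q ^ 2) (r + k + 1 + r)
      = qShifted (q ^ 2) (q ^ 2) r * qShifted (q ^ 2 * (q ^ 2) ^ r) (q ^ 2) (r + k + 1) := by
    rw [add_comm (r + k + 1) r, qShifted_add]
  rw [h2, h4, ← h1]
  linear_combination ((∏ j ∈ (range (r + k + 1)).erase r, (1 - q ^ (2 * r + 1) * q ^ (2 * j + 1)))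
      * (1 - q ^ (4 * r + 2)) * qShifted (q ^ 2) (q ^ 2) k) * h3

theorem pow_ne_pow_of_ne {q : K} (hq : q ≠ 0) (hq1 : ∀ k, 0 < k → q ^ k ≠ 1) {a b : ℕ}
    (h : a ≠ b) : q ^ a ≠ q ^ b := by
  intro hab
  rcases Nat.lt_or_gt_of_ne h with h | h
  · obtain ⟨k, rfl⟩ := Nat.exists_eq_add_of_lt h
    rw [add_assoc, pow_add] at hab
    exact hq1 (k + 1) (by omega) (mul_left_cancel₀ (pow_ne_zero a hq) (by rw [← hab, mul_one]))
  · obtain ⟨k, rfl⟩ := Nat.exists_eq_add_of_lt h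
    rw [add_assoc, pow_add] at hab
    exact hq1 (k + 1) (by omega) (mul_left_cancel₀ (pow_ne_zero b hq) (by rw [hab, mul_one]))

theorem qShifted_sq_ne_zero {q : K} (hq1 : ∀ k, 0 < k → q ^ k ≠ 1) (n : ℕ) :
    qShifted (q ^ 2) (q ^ 2) n ≠ 0 := by
  refine Finset.prod_ne_zero_iff.2 fun i _ => sub_ne_zero.2 ?_
  have := (hq1 (2 * i + 2) (by omega)).symm
  rwa [show q ^ 2 * (q ^ 2) ^ i = q ^ (2 * i + 2) by ring]

/-- Partial fractions of `(q; q²)_{n+1}⁻²`. -/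
theorem inv_qShifted_sq {q : K} (hq : q ≠ 0) (hq1 : ∀ k, 0 < k → q ^ k ≠ 1) (n : ℕ) :
    (qShifted q (q ^ 2) (n + 1) ^ 2)⁻¹ = ∑ r ∈ range (n + 1),
      (-1) ^ r * q ^ (r * (r + 1)) * (1 + q ^ (2 * r + 1)) * (1 - q ^ (2 * r + 1))⁻¹ *
        (qShifted (q ^ 2) (q ^ 2) (n - r))⁻¹ * (qShifted (q ^ 2) (q ^ 2) (n + r + 1))⁻¹ := by
  have key := div_prod_eq_sum (range (n + 1)) (fun r => q ^ (2 * r + 1))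
    (fun i _ => pow_ne_zero _ hq) (fun i _ => hq1 _ (by omega))
    (fun i _ j _ h => pow_ne_pow_of_ne hq hq1 (by omega))
    (fun i _ j _ h => by rw [← pow_add]; exact hq1 _ (by omega)) 1
    (by rw [Polynomial.degree_one]; simpa using Nat.cast_add_one_pos n)
  simp only [Polynomial.eval_one] at key
  have e1 : qShifted q (q ^ 2) (n + 1) ^ 2 = ∏ i ∈ range (n + 1), (1 - q ^ (2 * i + 1)) ^ 2 := by
    rw [qShifted, ← Finset.prod_pow]
    exact Finset.prod_congr rfl fun i _ => by ring
  rw [e1, ← one_div, key]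
  refine Finset.sum_congr rfl fun r hr => ?_
  obtain ⟨k, rfl⟩ := Nat.exists_eq_add_of_le (Nat.lt_succ_iff.1 (mem_range.1 hr))
  have h1 := prod_erase_one_sub hq r k
  rw [show r + k - r = k by omega, show r + k + r + 1 = r + k + 1 + r by ring]
  have n1 := qShifted_sq_ne_zero hq1 k
  have n2 := qShifted_sq_ne_zero hq1 (r + k + 1 + r)
  have n3 : (1 - q ^ (2 * r + 1)) ≠ 0 := sub_ne_zero.2 (hq1 _ (by omega)).symm
  have n4 : (1 - q ^ (4 * r + 2)) ≠ 0 := sub_ne_zero.2 (hq1 _ (by omega)).symm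
  have n5 : q ^ (r * (r + 1)) ≠ 0 := pow_ne_zero _ hq
  have n6 : ((-1 : K)) ^ r ≠ 0 := pow_ne_zero _ (by simp)
  set D := ∏ j ∈ (range (r + k + 1)).erase r, ((1 - q ^ (2 * r + 1) * q ^ (2 * j + 1)) *
        (1 - q ^ (2 * j + 1) / q ^ (2 * r + 1))) with hD
  have n7 : D ≠ 0 := by
    intro h0
    rw [h0, zero_mul] at h1
    exact mul_ne_zero (mul_ne_zero n6 n2) n1 h1.symm
  have n8 : ((-1 : K)) ^ r * (-1) ^ r = 1 := by rw [← mul_pow]; simp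
  rw [div_eq_iff (mul_ne_zero (pow_ne_zero _ n3) n7)]
  field_simp
  have e2 : (1 - q ^ (4 * r + 2)) = (1 + q ^ (2 * r + 1)) * (1 - q ^ (2 * r + 1)) := by ring
  rw [e2] at h1
  linear_combination (-(-1) ^ r) * h1 - (qShifted (q ^ 2) (q ^ 2) k
    * qShifted (q ^ 2) (q ^ 2) (r + k + 1 + r)) * n8

end PartialFractions

/-! ### Finite Appell–Lerch sums with poles of both signs. -/

section EvenPart

variable {K : Type*} [Field K]

theorem qShifted_neg_mul {R : Type*} [CommRing R] (a q : R) (n : ℕ) :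
    qShifted a q n * qShifted (-a) q n = qShifted (a ^ 2) (q ^ 2) n := by
  simp only [qShifted, ← Finset.prod_mul_distrib]
  exact Finset.prod_congr rfl fun i _ => by ring

/-- The sign attached to a Boolean. -/
def boolSign (K : Type*) [Ring K] (b : Bool) : K := if b then 1 else -1

theorem boolSign_sq (b : Bool) : boolSign K b * boolSign K b = 1 := by
  cases b <;> simp [boolSign]

theorem boolSign_not (b : Bool) : boolSign K (!b) = -boolSign K b := by
  cases b <;> simp [boolSign]

/-- These are the factors coming from the poles of opposite sign. The index j = r is not omitted,
and its second factor 1 + 1 gives the 2. -/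
theorem prod_one_add {q : K} (hq : q ≠ 0) (r k : ℕ) :
    (∏ j ∈ range (r + k + 1), ((1 + q ^ (2 * r + 1) * q ^ (2 * j + 1)) *
        (1 + q ^ (2 * j + 1) / q ^ (2 * r + 1)))) * q ^ (r * (r + 1))
      = 2 * qShifted (-q ^ 2) (q ^ 2) (r + k + 1 + r) * qShifted (-q ^ 2) (q ^ 2) k := by
  rw [Finset.prod_mul_distrib]
  have h1 : (∏ j ∈ range (r + k + 1), (1 + q ^ (2 * r + 1) * q ^ (2 * j + 1)))
      = qShifted (-q ^ 2 * (q ^ 2) ^ r) (q ^ 2) (r + k + 1) :=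
    Finset.prod_congr rfl fun j _ => by ring
  have h2 : (∏ j ∈ range (r + k + 1), (1 + q ^ (2 * j + 1) / q ^ (2 * r + 1)))
      = ∏ j ∈ range (r + (k + 1)), (1 - (-1) * q ^ (2 * j) / q ^ (2 * r)) :=
    Finset.prod_congr rfl fun j _ => by field_simp; ring
  have h3 := prod_one_sub_shift_pow hq (neg_ne_zero.2 (one_ne_zero : (1 : K) ≠ 0)) r (k + 1)
  have h4 : qShifted (-1 : K) (q ^ 2) (k + 1) = 2 * qShifted (-q ^ 2) (q ^ 2) k := by
    rw [qShifted, Finset.prod_range_succ', mul_comm]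
    congr 1
    · norm_num
    · exact Finset.prod_congr rfl fun j _ => by ring
  have h5 : qShifted (-q ^ 2) (q ^ 2) (r + k + 1 + r)
      = qShifted (-q ^ 2) (q ^ 2) r * qShifted (-q ^ 2 * (q ^ 2) ^ r) (q ^ 2) (r + k + 1) := by
    rw [add_comm (r + k + 1) r, qShifted_add]
  rw [h4, neg_neg, one_pow, inv_neg, inv_one, neg_one_mul] at h3
  rw [h1, h2, h5, mul_assoc, h3]
  ring

/-- This evaluates the numerator of the partial fractions in `sum_appellTerm` at a pole. The factor
1 + ε q^{2r+1} fills the gap left between the two products. -/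
theorem eval_node {q ε : K} (hq : q ≠ 0) (hε : ε * ε = 1) (r k : ℕ) :
    (∏ j ∈ range (r + k), ((1 + q ^ (2 * j + 2) * (ε * q ^ (2 * r + 1))) *
        (1 + q ^ (2 * j + 2) / (ε * q ^ (2 * r + 1))))) *
        ((1 + ε * q ^ (2 * r + 1)) * q ^ (r * (r + 1)))
      = (ε * q) ^ r * qShifted (-ε * q) (q ^ 2) (r + k + 1 + r)
        * qShifted (-ε * q) (q ^ 2) k := by
  have hε0 : ε ≠ 0 := left_ne_zero_of_mul_eq_one hε
  rw [Finset.prod_mul_distrib]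
  have h1 : (∏ j ∈ range (r + k), (1 + q ^ (2 * j + 2) * (ε * q ^ (2 * r + 1))))
      = qShifted (-ε * q * (q ^ 2) ^ (r + 1)) (q ^ 2) (r + k) :=
    Finset.prod_congr rfl fun j _ => by ring
  have h2 : (∏ j ∈ range (r + k), (1 + q ^ (2 * j + 2) / (ε * q ^ (2 * r + 1))))
      = ∏ j ∈ range (r + k), (1 - (-ε * q) * q ^ (2 * j) / q ^ (2 * r)) :=
    Finset.prod_congr rfl fun j _ => by
      have e : q ^ (2 * j + 2) / (ε * q ^ (2 * r + 1)) = ε * q * q ^ (2 * j) / q ^ (2 * r) := by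
        rw [div_eq_div_iff (mul_ne_zero hε0 (pow_ne_zero _ hq)) (pow_ne_zero _ hq)]
        linear_combination (-q ^ (2 * j + 2) * q ^ (2 * r)) * hε
      rw [e]
      ring
  have h3 := prod_one_sub_shift_pow hq (mul_ne_zero (neg_ne_zero.2 hε0) hq) r k
  have h4 : (-ε * q)⁻¹ * q ^ 2 = -ε * q := by
    field_simp
    linear_combination hε
  have h5 : qShifted (-ε * q) (q ^ 2) (r + k + 1 + r) = qShifted (-ε * q) (q ^ 2) r *
      (1 + ε * q ^ (2 * r + 1)) * qShifted (-ε * q * (q ^ 2) ^ (r + 1)) (q ^ 2) (r + k) := by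
    rw [show r + k + 1 + r = (r + 1) + (r + k) by ring, qShifted_add, qShifted_succ]
    ring
  rw [h4] at h3
  rw [h1, h2, h5]
  linear_combination (qShifted (-ε * q * (q ^ 2) ^ (r + 1)) (q ^ 2) (r + k) *
    (1 + ε * q ^ (2 * r + 1))) * h3

/-- The summand of the finite form of the Appell–Lerch sum. -/
def appellTerm (M : ℕ) (q ε : K) (n : ℕ) : K :=
  (-ε) ^ n * q ^ (n * (n + 2)) * (1 - ε * q ^ (2 * n + 1))⁻¹ *
    qShifted (-ε * q) (q ^ 2) (M + 1 + n) * qShifted (-ε * q) (q ^ 2) (M - n) *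
    (qShifted (q ^ 4) (q ^ 4) (M + 1 + n))⁻¹ * (qShifted (q ^ 4) (q ^ 4) (M - n))⁻¹

/-- Partial fractions with the 2(M+1) poles ±q^{2n+1}, one family of terms for each sign. The sign
-1 amounts to q ↦ -q (`appellTerm_neg`), so the sum is twice an even part. -/
theorem sum_appellTerm {q : K} (h2 : (2 : K) ≠ 0) (hq : q ≠ 0) (hq1 : ∀ k, 0 < k → q ^ k ≠ 1)
    (M : ℕ) :
    ∑ n ∈ range (M + 1), (appellTerm M q 1 n + appellTerm M q (-1) n)
      = 2 * qShifted (-q ^ 2) (q ^ 2) M ^ 2 * ((qShifted (q ^ 2) (q ^ 4) (M + 1))⁻¹) ^ 2 := by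
  set t : ℕ × Bool → K := fun i => boolSign K i.2 * q ^ (2 * i.1 + 1) with ht
  set s : Finset (ℕ × Bool) := range (M + 1) ×ˢ univ with hs
  have hb0 : ∀ b, boolSign K b ≠ 0 := fun b => left_ne_zero_of_mul_eq_one (boolSign_sq b)
  have htsq : ∀ i, t i ^ 2 = q ^ (4 * i.1 + 2) := by
    intro i
    simp only [ht]
    linear_combination (q ^ (4 * i.1 + 2)) * boolSign_sq (K := K) i.2
  have ht0 : ∀ i ∈ s, t i ≠ 0 := fun i _ => mul_ne_zero (hb0 _) (pow_ne_zero _ hq)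
  have ht1' : ∀ i, t i ^ 2 ≠ 1 := fun i => by rw [htsq]; exact hq1 _ (by omega)
  have ht1 : ∀ i ∈ s, t i ≠ 1 := fun i _ h => ht1' i (by rw [h, one_pow])
  have hinj : ∀ i ∈ s, ∀ j ∈ s, i ≠ j → t i ≠ t j := by
    intro i _ j _ hij h
    by_cases h1 : i.1 = j.1
    · have h3 : i.2 ≠ j.2 := fun h' => hij (Prod.ext h1 h')
      simp only [ht, h1] at h
      have h4 := mul_right_cancel₀ (pow_ne_zero _ hq) h
      have h5 : j.2 = !i.2 := by
        revert h3; cases i.2 <;> cases j.2 <;> simp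
      rw [h5, boolSign_not] at h4
      have h6 : 2 * boolSign K i.2 = 0 := by linear_combination h4
      rcases mul_eq_zero.1 h6 with h | h
      · exact h2 h
      · exact hb0 _ h
    · have := congrArg (· ^ 2) h
      simp only [htsq] at this
      exact pow_ne_pow_of_ne hq hq1 (by omega) this
  have hmul : ∀ i ∈ s, ∀ j ∈ s, i ≠ j → t i * t j ≠ 1 := by
    intro i _ j _ _ h
    have := congrArg (· ^ 2) h
    simp only [mul_pow, htsq, one_pow, ← pow_add] at this
    exact hq1 _ (by omega) this
  -- In y = x + 1/x this is ∏ (1 + q^{2j+2} x)(1 + q^{2j+2}/x), of degree at most M, below the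
  -- number 2(M+1) of nodes.
  set f : Polynomial K := ∏ j ∈ range M,
    (Polynomial.C (q ^ (2 * j + 2)) * Polynomial.X + Polynomial.C (1 + (q ^ (2 * j + 2)) ^ 2))
    with hf
  have hfdeg : f.degree < #s := by
    have h1 : f.natDegree ≤ M := by
      refine (Polynomial.natDegree_prod_le _ _).trans ?_
      refine (Finset.sum_le_card_nsmul _ _ 1 fun j _ => ?_).trans (by simp)
      exact Polynomial.natDegree_linear_le
    have h3 : #s = 2 * (M + 1) := by
      rw [hs, Finset.card_product, card_range]
      simp [mul_comm]
    refine (Polynomial.degree_le_natDegree).trans_lt ?_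
    rw [h3]
    exact_mod_cast (by omega : f.natDegree < 2 * (M + 1))
  have hfe : ∀ x : K, x ≠ 0 → f.eval (x + x⁻¹) = ∏ j ∈ range M,
      ((1 + q ^ (2 * j + 2) * x) * (1 + q ^ (2 * j + 2) / x)) := by
    intro x hx
    rw [hf, Polynomial.eval_prod]
    refine Finset.prod_congr rfl fun j _ => ?_
    simp only [Polynomial.eval_add, Polynomial.eval_mul, Polynomial.eval_C, Polynomial.eval_X]
    field_simp
    ring
  have key := div_prod_eq_sum s t ht0 ht1 hinj hmul f hfdeg
  have e1 : f.eval 2 = qShifted (-q ^ 2) (q ^ 2) M ^ 2 := by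
    have := hfe 1 one_ne_zero
    rw [inv_one, one_add_one_eq_two] at this
    rw [this, qShifted, ← Finset.prod_pow]
    exact Finset.prod_congr rfl fun j _ => by ring
  have e2 : ∏ i ∈ s, (1 - t i) ^ 2 = qShifted (q ^ 2) (q ^ 4) (M + 1) ^ 2 := by
    rw [hs, Finset.prod_product, qShifted, ← Finset.prod_pow]
    refine Finset.prod_congr rfl fun j _ => ?_
    simp only [ht, Fintype.prod_bool, boolSign, if_true, Bool.false_eq_true, if_false]
    ring
  rw [e1, e2] at key
  have e3 : ∀ n ∈ range (M + 1), ∀ b : Bool, f.eval (t (n, b) + (t (n, b))⁻¹) /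
      ((1 - t (n, b)) ^ 2 * ∏ j ∈ s.erase (n, b), ((1 - t (n, b) * t j) * (1 - t j / t (n, b))))
      = appellTerm M q (boolSign K b) n / 2 := by
    intro n hn b
    obtain ⟨k, rfl⟩ := Nat.exists_eq_add_of_le (Nat.lt_succ_iff.1 (mem_range.1 hn))
    -- The other poles are those of the same sign with index different from n, and all those of
    -- opposite sign, index n included.
    have hse : s.erase (n, b) = ((range (n + k + 1)).erase n ×ˢ {b})
        ∪ (range (n + k + 1) ×ˢ {!b}) := by
      ext ⟨m, c⟩
      simp only [hs, mem_erase, mem_product, mem_union, mem_singleton, mem_univ, and_true, ne_eq,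
        Prod.mk.injEq]
      cases b <;> cases c <;> simp
    have hε := boolSign_sq (K := K) b
    have hd := hb0 b
    have htn : t (n, b) = boolSign K b * q ^ (2 * n + 1) := rfl
    rw [hse, Finset.prod_union, Finset.prod_product, Finset.prod_product]
    swap
    · rw [Finset.disjoint_left]
      rintro ⟨m, c⟩ h h'
      simp only [mem_product, mem_singleton] at h h'
      rw [h.2] at h'
      cases b <;> simp at h'
    simp only [prod_singleton]
    have p1 : ∏ x ∈ (range (n + k + 1)).erase n, ((1 - t (n, b) * t (x, b)) *
        (1 - t (x, b) / t (n, b))) = ∏ j ∈ (range (n + k + 1)).erase n,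
        ((1 - q ^ (2 * n + 1) * q ^ (2 * j + 1)) * (1 - q ^ (2 * j + 1) / q ^ (2 * n + 1))) := by
      refine Finset.prod_congr rfl fun j _ => ?_
      simp only [ht]
      rw [mul_div_mul_left _ _ hd]
      congr 2
      linear_combination (q ^ (2 * n + 1) * q ^ (2 * j + 1)) * hε
    have p2 : ∏ x ∈ range (n + k + 1), ((1 - t (n, b) * t (x, !b)) *
        (1 - t (x, !b) / t (n, b))) = ∏ j ∈ range (n + k + 1),
        ((1 + q ^ (2 * n + 1) * q ^ (2 * j + 1)) * (1 + q ^ (2 * j + 1) / q ^ (2 * n + 1))) := by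
      refine Finset.prod_congr rfl fun j _ => ?_
      simp only [ht, boolSign_not]
      rw [neg_mul, neg_div, mul_div_mul_left _ _ hd, sub_neg_eq_add]
      congr 1
      linear_combination (q ^ (2 * n + 1) * q ^ (2 * j + 1)) * hε
    rw [p1, p2, hfe _ (ht0 _ (mem_product.2 ⟨hn, mem_univ _⟩)), htn]
    have l1 := prod_erase_one_sub hq n k
    have l2 := prod_one_add hq n k
    have l3 := eval_node hq hε n k
    have w1 := qShifted_neg_mul (q ^ 2) (q ^ 2) (n + k + 1 + n)
    have w2 := qShifted_neg_mul (q ^ 2) (q ^ 2) k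
    rw [← pow_mul] at w1 w2
    have hq1' : ∀ k, 0 < k → (q ^ 2) ^ k ≠ 1 := fun k hk => by
      rw [← pow_mul]; exact hq1 _ (by omega)
    have w1n := qShifted_sq_ne_zero hq1' (n + k + 1 + n)
    have w2n := qShifted_sq_ne_zero hq1' k
    rw [← pow_mul] at w1n w2n
    unfold appellTerm
    rw [show n + k - n = k by omega]
    norm_num at w1 w2 w1n w2n
    generalize boolSign K b = ε at *
    generalize (∏ j ∈ (range (n + k + 1)).erase n, ((1 - q ^ (2 * n + 1) * q ^ (2 * j + 1)) *
      (1 - q ^ (2 * j + 1) / q ^ (2 * n + 1)))) = A at *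
    generalize (∏ j ∈ range (n + k + 1), ((1 + q ^ (2 * n + 1) * q ^ (2 * j + 1)) *
      (1 + q ^ (2 * j + 1) / q ^ (2 * n + 1)))) = B at *
    generalize (∏ j ∈ range (n + k), ((1 + q ^ (2 * j + 2) * (ε * q ^ (2 * n + 1))) *
        (1 + q ^ (2 * j + 2) / (ε * q ^ (2 * n + 1))))) = D at *
    have hx := ht1' (n, b)
    rw [htn] at hx
    generalize qShifted (q ^ 4) (q ^ 4) (n + k + 1 + n) = W1 at *
    generalize qShifted (q ^ 4) (q ^ 4) k = W2 at *
    generalize qShifted (q ^ 2) (q ^ 2) (n + k + 1 + n) = Q1 at *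
    generalize qShifted (q ^ 2) (q ^ 2) k = Q2 at *
    generalize qShifted (-q ^ 2) (q ^ 2) (n + k + 1 + n) = Q3 at *
    generalize qShifted (-q ^ 2) (q ^ 2) k = Q4 at *
    have hm : (1 - ε * q ^ (2 * n + 1)) ≠ 0 := fun h => hx (by
      rw [← sub_eq_zero.1 h, one_pow])
    have hp : (1 + ε * q ^ (2 * n + 1)) ≠ 0 := fun h => hx (by
      linear_combination (ε * q ^ (2 * n + 1) - 1) * h)
    have h4n : (1 - q ^ (4 * n + 2))
        = (1 - ε * q ^ (2 * n + 1)) * (1 + ε * q ^ (2 * n + 1)) := by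
      linear_combination (q ^ (4 * n + 2)) * hε
    rw [h4n] at l1
    have hqA := pow_ne_zero (n * (n + 1)) hq
    have hQ : Q1 * Q3 ≠ 0 := by rw [w1]; exact w1n
    have hQ' : Q2 * Q4 ≠ 0 := by rw [w2]; exact w2n
    have hA : A ≠ 0 := by
      rintro rfl
      rw [zero_mul] at l1
      exact mul_ne_zero (mul_ne_zero (pow_ne_zero _ (by simp)) (left_ne_zero_of_mul hQ))
        (left_ne_zero_of_mul hQ') l1.symm
    have hB : B ≠ 0 := by
      rintro rfl
      rw [zero_mul] at l2
      exact mul_ne_zero (mul_ne_zero h2 (right_ne_zero_of_mul hQ))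
        (right_ne_zero_of_mul hQ') l2.symm
    rw [div_eq_div_iff (mul_ne_zero (pow_ne_zero _ hm) (mul_ne_zero hA hB)) h2]
    set R1 := qShifted (-ε * q) (q ^ 2) (n + k + 1 + n)
    set R2 := qShifted (-ε * q) (q ^ 2) k
    have hfin : D * 2 * ((1 - ε * q ^ (2 * n + 1)) * W1 * W2)
        = (-ε) ^ n * q ^ (n * (n + 2)) * R1 * R2 * ((1 - ε * q ^ (2 * n + 1)) ^ 2 * (A * B)) := by
      apply mul_left_cancel₀ (mul_ne_zero hp (mul_ne_zero hqA hqA))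
      have s1 : q ^ (n * (n + 2)) = q ^ (n * (n + 1)) * q ^ n := by ring
      have s2 : (-ε) ^ n * (-1) ^ n = ε ^ n := by rw [← mul_pow]; ring_nf
      calc _ = (D * ((1 + ε * q ^ (2 * n + 1)) * q ^ (n * (n + 1)))) *
            (2 * q ^ (n * (n + 1)) * ((1 - ε * q ^ (2 * n + 1)) * W1 * W2)) := by ring
        _ = ((-ε) ^ n * q ^ (n * (n + 2)) * R1 * R2) * (1 - ε * q ^ (2 * n + 1)) *
            (((-1) ^ n * Q1 * Q2) * (2 * Q3 * Q4)) := by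
              rw [l3, ← w1, ← w2, s1, mul_pow, ← s2]
              ring
        _ = _ := by rw [← l1, ← l2]; ring
    have hT : (-ε) ^ n * q ^ (n * (n + 2)) * (1 - ε * q ^ (2 * n + 1))⁻¹ * R1 * R2 * W1⁻¹ * W2⁻¹
        = ((-ε) ^ n * q ^ (n * (n + 2)) * R1 * R2) / ((1 - ε * q ^ (2 * n + 1)) * W1 * W2) := by
      rw [div_eq_mul_inv, mul_inv, mul_inv]
      ring
    rw [hT, div_mul_eq_mul_div, eq_div_iff (mul_ne_zero (mul_ne_zero hm w1n) w2n)]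
    exact hfin
  rw [Finset.sum_congr rfl (g := fun i : ℕ × Bool => appellTerm M q (boolSign K i.2) i.1 / 2)
    (fun i hi => e3 i.1 (by simpa [hs] using hi) i.2), hs, Finset.sum_product] at key
  simp only [Fintype.sum_bool, boolSign, if_true, Bool.false_eq_true, if_false, ← add_div] at key
  rw [← Finset.sum_div] at key
  rw [eq_div_iff h2] at key
  rw [← key, div_eq_mul_inv, inv_pow]
  ring

end EvenPart

/-! ### Descent of the identities from the fraction field to ℤ⟦X⟧. -/

section Transfer

/-- The embedding of `ℤ⟦X⟧` into its field of fractions. -/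
noncomputable abbrev toFrac : ℤ⟦X⟧ →+* FractionRing ℤ⟦X⟧ := algebraMap _ _

theorem toFrac_injective : Function.Injective toFrac := IsFractionRing.injective _ _

theorem map_iv_field {K : Type*} [Field K] (φ : ℤ⟦X⟧ →+* K) {f : ℤ⟦X⟧}
    (h : constantCoeff f = 1) : φ (iv f) = (φ f)⁻¹ := by
  apply eq_inv_of_mul_eq_one_right
  rw [← map_mul, mul_iv h, map_one]

theorem toFrac_X_ne_zero : toFrac X ≠ 0 := by
  rw [Ne, map_eq_zero_iff _ toFrac_injective]
  exact X_ne_zero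

theorem toFrac_X_pow_ne_one (k : ℕ) (hk : 0 < k) : toFrac X ^ k ≠ 1 := by
  rw [← map_pow, ← map_one toFrac]
  intro h
  have := congrArg constantCoeff (toFrac_injective h)
  simp [hk.ne'] at this

theorem iv_phiDenom (n : ℕ) : iv (phiDenom n) = ∑ r ∈ range (n + 1),
    (-1) ^ r * X ^ (r * (r + 1)) * (1 + X ^ (2 * r + 1)) * iv (1 - X ^ (2 * r + 1)) *
      ivQ2 (n - r) * ivQ2 (n + r + 1) := by
  apply toFrac_injective
  have h1 : ∀ n, constantCoeff (qShifted (X ^ 2 : ℤ⟦X⟧) (X ^ 2) n) = 1 :=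
    fun n => constantCoeff_qShifted (by simp) n
  have h2 : constantCoeff (phiDenom n) = 1 := by
    rw [phiDenom, map_pow, constantCoeff_qShifted (by simp), one_pow]
  have h3 : ∀ r : ℕ, constantCoeff (1 - X ^ (2 * r + 1) : ℤ⟦X⟧) = 1 := by simp
  rw [map_iv_field _ h2, phiDenom, map_pow, map_qShifted, map_pow,
    inv_qShifted_sq toFrac_X_ne_zero toFrac_X_pow_ne_one, map_sum]
  refine Finset.sum_congr rfl fun r _ => ?_
  simp only [map_mul, ivQ2, map_iv_field _ (h1 _), map_iv_field _ (h3 _), map_qShifted, map_pow,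
    map_add, map_sub, map_neg, map_one]

/-- The summand of the finite form of the Appell–Lerch sum, as a power series. -/
noncomputable def appellSeries (M n : ℕ) : ℤ⟦X⟧ :=
  (-1) ^ n * X ^ (n * (n + 2)) * iv (1 - X ^ (2 * n + 1)) *
    qShifted (-X) (X ^ 2) (M + 1 + n) * qShifted (-X) (X ^ 2) (M - n) *
    iv (qShifted (X ^ 4) (X ^ 4) (M + 1 + n)) * iv (qShifted (X ^ 4) (X ^ 4) (M - n))

theorem map_appellSeries {K : Type*} [Field K] (φ : ℤ⟦X⟧ →+* K) (M n : ℕ) :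
    φ (appellSeries M n) = appellTerm M (φ X) 1 n := by
  have h1 : ∀ n, constantCoeff (qShifted (X ^ 4 : ℤ⟦X⟧) (X ^ 4) n) = 1 :=
    fun n => constantCoeff_qShifted (by simp) n
  have h3 : ∀ r : ℕ, constantCoeff (1 - X ^ (2 * r + 1) : ℤ⟦X⟧) = 1 := by simp
  simp only [appellSeries, appellTerm, map_mul, map_iv_field _ (h1 _), map_iv_field _ (h3 _),
    map_qShifted, map_pow, map_sub, map_neg, map_one, one_mul, neg_mul]

theorem appellTerm_neg {K : Type*} [Field K] (M n : ℕ) (q : K) :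
    appellTerm M (-q) 1 n = appellTerm M q (-1) n := by
  have e1 : (-q) ^ (n * (n + 2)) = (-1) ^ n * q ^ (n * (n + 2)) := by
    rw [neg_pow, pow_mul (-1 : K) n]
    rcases Nat.even_or_odd n with h | h
    · rw [h.neg_one_pow, one_pow]
    · rw [h.neg_one_pow, (h.add_even even_two).neg_one_pow]
  have e2 : (-q) ^ (2 * n + 1) = -q ^ (2 * n + 1) := (odd_two_mul_add_one n).neg_pow q
  have e3 : (-q) ^ 2 = q ^ 2 := by ring
  have e4 : (-q) ^ 4 = q ^ 4 := by ring
  have e5 : ((-1 : K)) ^ n * (-1) ^ n = 1 := by rw [← mul_pow]; simp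
  unfold appellTerm
  rw [e1, e2, e3, e4, ← mul_assoc, e5, neg_neg, one_pow]
  simp only [one_mul, neg_mul, neg_neg, mul_neg]

theorem sum_appellSeries (M : ℕ) :
    ∑ n ∈ range (M + 1), appellSeries M n + evalNegHom (∑ n ∈ range (M + 1), appellSeries M n)
      = 2 * qShifted (-X ^ 2) (X ^ 2) M ^ 2 * iv (qShifted (X ^ 2) (X ^ 4) (M + 1)) ^ 2 := by
  apply toFrac_injective
  have h1 : constantCoeff (qShifted (X ^ 2 : ℤ⟦X⟧) (X ^ 4) (M + 1)) = 1 :=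
    constantCoeff_qShifted (by simp) _
  have h2 : (2 : FractionRing ℤ⟦X⟧) ≠ 0 := by
    rw [← map_ofNat toFrac 2, Ne, map_eq_zero_iff _ toFrac_injective]
    intro h
    have := congrArg constantCoeff h
    rw [map_ofNat, map_zero] at this
    norm_num at this
  have key := sum_appellTerm h2 toFrac_X_ne_zero toFrac_X_pow_ne_one M
  have h3 : ∀ f, toFrac (evalNegHom f) = (toFrac.comp evalNegHom) f := fun f => rfl
  rw [map_add, h3, map_sum, map_sum, ← Finset.sum_add_distrib]
  simp only [map_appellSeries, map_mul, map_pow, map_qShifted, map_iv_field _ h1, map_neg]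
  rw [map_ofNat, ← key]
  refine Finset.sum_congr rfl fun n _ => ?_
  congr 1
  rw [RingHom.comp_apply, evalNegHom_X, map_neg, appellTerm_neg]

end Transfer

/-! ### The Appell–Lerch form of φ and its odd coefficients. -/

/-- The partial Appell–Lerch sum. -/
noncomputable def appellSum (M : ℕ) : ℤ⟦X⟧ :=
  ∑ r ∈ range M, (-1) ^ r * X ^ (r * (r + 2)) * iv (1 - X ^ (2 * r + 1))

theorem ramanujanPhi_eqMod_sum (M : ℕ) :
    EqMod M ramanujanPhi (∑ n ∈ range M, phiTerm n) := by
  apply EqMod.of_coeff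
  intro k hk
  have := phiCoeff_eq_sum k
  rw [phiCoeff] at this
  rw [this, map_sum]
  refine Finset.sum_subset (range_subset_range.2 hk.le) fun n _ hn => ?_
  exact coeff_phiTerm_of_le (by simpa using hn)

theorem sum_phiTerm (M : ℕ) : ∑ n ∈ range M, phiTerm n = ∑ r ∈ range M,
    (-1) ^ r * X ^ (r * (r + 1)) * iv (1 - X ^ (2 * r + 1)) *
      ((1 + X ^ (2 * r + 1)) * baileySum r (M - r)) := by
  have h1 : ∀ n, phiTerm n = ∑ r ∈ Ico 0 (n + 1), qShifted (-X) X (2 * n) * X ^ (n + 1) *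
      ((-1) ^ r * X ^ (r * (r + 1)) * (1 + X ^ (2 * r + 1)) * iv (1 - X ^ (2 * r + 1)) *
      ivQ2 (n - r) * ivQ2 (n + r + 1)) := by
    intro n
    rw [← Finset.mul_sum, ← Finset.range_eq_Ico, ← iv_phiDenom]
    rfl
  rw [Finset.sum_congr rfl fun n _ => h1 n, Finset.range_eq_Ico, ← Finset.sum_Ico_Ico_comm]
  refine Finset.sum_congr rfl fun r _ => ?_
  rw [Finset.sum_Ico_eq_sum_range, baileySum, Finset.mul_sum, Finset.mul_sum]
  refine Finset.sum_congr rfl fun s _ => ?_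
  rw [baileyTerm, show r + s - r = s by omega, show r + s + r + 1 = 2 * r + s + 1 by ring]
  ring

/-- The Appell–Lerch form of `φ`. -/
theorem ramanujanPhi_eqMod (M : ℕ) :
    EqMod M ramanujanPhi (X * appellSum M * (eulerJ2 * iv eulerJ ^ 2)) := by
  refine (ramanujanPhi_eqMod_sum M).trans ?_
  rw [sum_phiTerm, appellSum, Finset.mul_sum, Finset.sum_mul]
  refine EqMod.sum fun r hr => ?_
  have h1 := (baileySum_eqMod r (M - r)).mono (by simp at hr; omega : M ≤ r + 1 + (M - r))
  exact ((EqMod.refl M _).mul h1).trans (EqMod.of_eq (by ring))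

theorem qShifted_neg_odd_eqMod (n : ℕ) :
    EqMod (2 * n + 1) (qShifted (-X : ℤ⟦X⟧) (X ^ 2) n)
      (eulerJ2 ^ 2 * iv eulerJ * iv eulerJ4) := by
  have h1 := qShifted_neg_mul (X : ℤ⟦X⟧) (X ^ 2) n
  have h2 := congrArg (expand 2 two_ne_zero) (qShifted_odd_mul_even n)
  have he : ∀ a q : ℤ⟦X⟧, expand 2 two_ne_zero (qShifted a q n)
      = qShifted (expand 2 two_ne_zero a) (expand 2 two_ne_zero q) n :=
    fun a q => map_qShifted (expand 2 two_ne_zero : ℤ⟦X⟧ →ₐ[ℤ] ℤ⟦X⟧).toRingHom a q n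
  have he' : ∀ a q : ℤ⟦X⟧, expand 2 two_ne_zero (qShifted a q (2 * n))
      = qShifted (expand 2 two_ne_zero a) (expand 2 two_ne_zero q) (2 * n) :=
    fun a q => map_qShifted (expand 2 two_ne_zero : ℤ⟦X⟧ →ₐ[ℤ] ℤ⟦X⟧).toRingHom a q _
  rw [map_mul, he, he, he'] at h2
  simp only [map_pow, expand_X, ← pow_mul] at h1 h2
  norm_num at h1 h2
  have c4 : constantCoeff (qShifted (X ^ 4 : ℤ⟦X⟧) (X ^ 4) n) = 1 :=
    constantCoeff_qShifted (by simp) _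
  have c1 : constantCoeff (qShifted (X : ℤ⟦X⟧) (X ^ 2) n) = 1 :=
    constantCoeff_qShifted (by simp) _
  have i4 := mul_iv c4
  have i1 := mul_iv c1
  have e : qShifted (-X : ℤ⟦X⟧) (X ^ 2) n = qShifted (X ^ 2) (X ^ 2) (2 * n)
      * iv (qShifted (X ^ 4) (X ^ 4) n) * iv (qShifted X (X ^ 2) n) := by
    rw [← h2, ← h1]
    linear_combination (-qShifted (-X : ℤ⟦X⟧) (X ^ 2) n) * i1
      - (qShifted (-X : ℤ⟦X⟧) (X ^ 2) n * (qShifted (X : ℤ⟦X⟧) (X ^ 2) n *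
        iv (qShifted X (X ^ 2) n))) * i4
  have j1 : iv (eulerJ * iv eulerJ2) = iv eulerJ * eulerJ2 := by
    apply iv_eq_of_mul_eq_one (by simp)
    linear_combination (mul_iv constantCoeff_eulerJ) * (eulerJ2 * iv eulerJ2)
      + mul_iv (f := eulerJ2) (by simp)
  rw [e]
  refine ((((qShifted_expand_eqMod 2 two_ne_zero (2 * n)).mono (by omega)).mul
    (((qShifted_expand_eqMod 4 four_ne_zero n).mono (by omega)).iv c4 (by simp))).mul
    ((qShifted_odd_eqMod n).iv c1 (by simp))).trans (EqMod.of_eq ?_)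
  rw [j1]
  ring

theorem iv_qShifted_four_eqMod (n : ℕ) :
    EqMod (4 * (n + 1)) (iv (qShifted (X ^ 4) (X ^ 4) n)) (iv eulerJ4) :=
  (qShifted_expand_eqMod 4 four_ne_zero n).iv (constantCoeff_qShifted (by simp) _) (by simp)

theorem sum_appellSeries_eqMod (M : ℕ) :
    EqMod (2 * M) (∑ n ∈ range (M + 1), appellSeries M n)
      (appellSum (M + 1) * ((eulerJ2 ^ 2 * iv eulerJ * iv eulerJ4) ^ 2 * iv eulerJ4 ^ 2)) := by
  rw [appellSum, Finset.sum_mul]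
  refine EqMod.sum fun n hn => ?_
  have hn' : n ≤ M := by simp at hn; omega
  have key : EqMod (2 * (M - n) + 1) (qShifted (-X : ℤ⟦X⟧) (X ^ 2) (M + 1 + n) *
      qShifted (-X) (X ^ 2) (M - n) * iv (qShifted (X ^ 4) (X ^ 4) (M + 1 + n)) *
      iv (qShifted (X ^ 4) (X ^ 4) (M - n)))
      ((eulerJ2 ^ 2 * iv eulerJ * iv eulerJ4) ^ 2 * iv eulerJ4 ^ 2) := by
    refine (((((qShifted_neg_odd_eqMod _).mono ?_).mul ((qShifted_neg_odd_eqMod _).mono ?_)).mul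
      ((iv_qShifted_four_eqMod _).mono ?_)).mul ((iv_qShifted_four_eqMod _).mono ?_)).trans
      (EqMod.of_eq (by ring)) <;> omega
  -- The monomial makes up for the precision lost when M - n is small: n(n+2) + 2(M-n) + 1 = n² + 2M
  -- + 1.
  have h2 := (((EqMod.refl _ ((-1) ^ n * iv (1 - X ^ (2 * n + 1)))).mul key).X_pow_mul
    (n * (n + 2))).mono (by nlinarith [Nat.sub_add_cancel hn'] : 2 * M ≤ n * (n + 2) + (2 * (M - n) + 1))
  refine (EqMod.of_eq ?_).trans (h2.trans (EqMod.of_eq ?_))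
  · unfold appellSeries; ring
  · ring

theorem expand_two_eulerJ2 : expand 2 two_ne_zero eulerJ2 = eulerJ4 := by
  exact (expand_mul 2 two_ne_zero 2 two_ne_zero eulerJ).symm

theorem evalNegHom_expand_two (f : ℤ⟦X⟧) :
    evalNegHom (expand 2 two_ne_zero f) = expand 2 two_ne_zero f := by
  ext n
  rw [evalNegHom, coeff_rescale, coeff_expand]
  split_ifs with h
  · obtain ⟨k, rfl⟩ := h
    rw [pow_mul]
    simp
  · simp

theorem EqMod.evalNeg {M : ℕ} {f g : ℤ⟦X⟧} (h : EqMod M f g) :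
    EqMod M (evalNegHom f) (evalNegHom g) := by
  obtain ⟨c, hc⟩ := h
  refine ⟨(-1) ^ M * evalNegHom c, ?_⟩
  rw [← map_sub, hc, map_mul, map_pow, evalNegHom_X, neg_pow]
  ring

theorem ramanujanPhi_sub_evalNeg :
    ramanujanPhi - evalNegHom ramanujanPhi
      = 2 * X * expand 2 two_ne_zero (eulerJ2 ^ 8 * iv eulerJ ^ 7) := by
  have i1 : eulerJ * iv eulerJ = 1 := mul_iv (by simp)
  have i2 : eulerJ2 * iv eulerJ2 = 1 := mul_iv (by simp)
  have i4 : eulerJ4 * iv eulerJ4 = 1 := mul_iv (by simp)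
  have m2 : evalNegHom eulerJ2 = eulerJ2 := evalNegHom_expand_two _
  have m4 : evalNegHom eulerJ4 = eulerJ4 := by
    rw [← expand_two_eulerJ2, evalNegHom_expand_two]
  have mi4 : evalNegHom (iv eulerJ4) = iv eulerJ4 := by
    rw [map_iv (by simp) (by rw [m4]; simp), m4]
  have hexp : expand 2 two_ne_zero (eulerJ2 ^ 8 * iv eulerJ ^ 7) = eulerJ4 ^ 8 * iv eulerJ2 ^ 7 := by
    have : expand 2 two_ne_zero (iv eulerJ) = iv eulerJ2 := by
      refine (map_iv (φ := (expand 2 two_ne_zero : ℤ⟦X⟧ →ₐ[ℤ] ℤ⟦X⟧).toRingHom)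
        constantCoeff_eulerJ ?_)
      exact constantCoeff_eulerJE 2 two_ne_zero
    rw [map_mul, map_pow, map_pow, expand_two_eulerJ2, this]
  -- The prefactor turns φ into X times the limit of the finite sums `E`. It is even in q while X is
  -- odd, so φ(q) - φ(-q) corresponds to E(q) + E(-q).
  have main : eulerJ2 ^ 3 * iv eulerJ4 ^ 4 * (ramanujanPhi - evalNegHom ramanujanPhi)
      = 2 * X * (eulerJ4 ^ 4 * iv eulerJ2 ^ 4) := by
    apply EqMod.eq
    intro M
    set E := ∑ n ∈ range (M + 1), appellSeries M n with hE
    have h1 : EqMod M (X * E) (eulerJ2 ^ 3 * iv eulerJ4 ^ 4 * ramanujanPhi) := by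
      have a1 := ((EqMod.refl _ X).mul (sum_appellSeries_eqMod M)).mono (by omega : M ≤ 2 * M)
      have a2 := ((EqMod.refl _ (eulerJ2 ^ 3 * iv eulerJ4 ^ 4)).mul
        (ramanujanPhi_eqMod (M + 1))).mono (by omega : M ≤ M + 1)
      refine a1.trans ((EqMod.of_eq ?_).trans a2.symm)
      ring
    have h2 := h1.evalNeg
    simp only [map_mul, map_pow, evalNegHom_X, m2, mi4] at h2
    have h3 := h1.sub h2
    have h4 := sum_appellSeries M
    rw [← hE] at h4
    have he : ∀ a q : ℤ⟦X⟧, ∀ n, expand 2 two_ne_zero (qShifted a q n)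
        = qShifted (expand 2 two_ne_zero a) (expand 2 two_ne_zero q) n :=
      fun a q n => map_qShifted (expand 2 two_ne_zero : ℤ⟦X⟧ →ₐ[ℤ] ℤ⟦X⟧).toRingHom a q n
    have h5 := (qShifted_neg_X_eqMod M).expand 2 two_ne_zero
    have h6 := (qShifted_odd_eqMod (M + 1)).expand 2 two_ne_zero
    have exi : expand 2 two_ne_zero (iv eulerJ) = iv eulerJ2 := by
      refine (map_iv (φ := (expand 2 two_ne_zero : ℤ⟦X⟧ →ₐ[ℤ] ℤ⟦X⟧).toRingHom)
        constantCoeff_eulerJ ?_)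
      exact constantCoeff_eulerJE 2 two_ne_zero
    have exi2 : expand 2 two_ne_zero (iv eulerJ2) = iv eulerJ4 := by
      rw [← expand_two_eulerJ2]
      refine (map_iv (φ := (expand 2 two_ne_zero : ℤ⟦X⟧ →ₐ[ℤ] ℤ⟦X⟧).toRingHom)
        (constantCoeff_eulerJE 2 two_ne_zero) ?_)
      change constantCoeff (expand 2 two_ne_zero eulerJ2) = 1
      rw [expand_two_eulerJ2]
      exact constantCoeff_eulerJE 4 four_ne_zero
    have exj : expand 2 two_ne_zero eulerJ = eulerJ2 := rfl
    rw [he, map_mul, expand_two_eulerJ2, exi, map_neg, expand_X] at h5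
    rw [he, map_mul, exi2, exj, map_pow, expand_X, ← pow_mul] at h6
    norm_num at h6
    have j1 : iv (eulerJ2 * iv eulerJ4) = iv eulerJ2 * eulerJ4 := by
      apply iv_eq_of_mul_eq_one (by simp)
      linear_combination i2 * (eulerJ4 * iv eulerJ4) + i4
    have h7 := h6.iv (constantCoeff_qShifted (by simp) _) (by simp)
    rw [j1] at h7
    have h8 := (((EqMod.refl M (2 * X)).mul ((h5.mono (by omega : M ≤ _)).pow 2)).mul
      ((h7.mono (by omega : M ≤ _)).pow 2))
    refine (EqMod.of_eq ?_).trans (h3.symm.trans ((EqMod.of_eq ?_).trans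
      (h8.trans (EqMod.of_eq ?_))))
    · ring
    · linear_combination X * h4
    · ring
  have e1 : ramanujanPhi - evalNegHom ramanujanPhi = eulerJ4 ^ 4 * iv eulerJ2 ^ 3 *
      (eulerJ2 ^ 3 * iv eulerJ4 ^ 4 * (ramanujanPhi - evalNegHom ramanujanPhi)) := by
    have p2 : eulerJ2 ^ 3 * iv eulerJ2 ^ 3 = 1 := by rw [← mul_pow, i2, one_pow]
    have p4 : eulerJ4 ^ 4 * iv eulerJ4 ^ 4 = 1 := by rw [← mul_pow, i4, one_pow]
    linear_combination (-(ramanujanPhi - evalNegHom ramanujanPhi)) * p2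
      - (ramanujanPhi - evalNegHom ramanujanPhi) * (eulerJ2 ^ 3 * iv eulerJ2 ^ 3) * p4
  rw [e1, main, hexp]
  ring

/-- The generating function of the odd-indexed coefficients of `φ`. -/
theorem phiCoeff_two_mul_add_one (n : ℕ) :
    phiCoeff (2 * n + 1) = coeff n (eulerJ2 ^ 8 * iv eulerJ ^ 7) := by
  have h := congrArg (coeff (2 * n + 1)) ramanujanPhi_sub_evalNeg
  rw [map_sub, evalNegHom, coeff_rescale, mul_assoc, ← map_ofNat C 2, coeff_C_mul,
    coeff_succ_X_mul, coeff_expand_mul, (odd_two_mul_add_one n).neg_one_pow] at h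
  unfold phiCoeff
  linarith

/-! ### Gaussian binomials and the q-binomial theorem. -/

section GaussianBinomials

variable {R : Type*} [CommRing R]

/-- Gaussian binomial coefficients. -/
def qBin (q : R) : ℕ → ℕ → R
  | _, 0 => 1
  | 0, _ + 1 => 0
  | n + 1, k + 1 => qBin q n k + q ^ (k + 1) * qBin q n (k + 1)

@[simp] theorem qBin_zero_right (q : R) (n : ℕ) : qBin q n 0 = 1 := by cases n <;> rfl

theorem qBin_succ_succ (q : R) (n k : ℕ) :
    qBin q (n + 1) (k + 1) = qBin q n k + q ^ (k + 1) * qBin q n (k + 1) := rfl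

theorem qBin_eq_zero (q : R) : ∀ n k, n < k → qBin q n k = 0
  | _, 0, h => absurd h (Nat.not_lt_zero _)
  | 0, _ + 1, _ => rfl
  | n + 1, k + 1, h => by
    rw [qBin_succ_succ, qBin_eq_zero q n k (by omega), qBin_eq_zero q n (k + 1) (by omega)]
    simp

theorem qBin_self (q : R) (n : ℕ) : qBin q n n = 1 := by
  induction n with
  | zero => rfl
  | succ n ih => rw [qBin_succ_succ, ih, qBin_eq_zero q n (n + 1) (by omega)]; simp

theorem qBin_mul_qShifted (q : R) (k l : ℕ) :
    qBin q (k + l) k * qShifted q q k * qShifted q q l = qShifted q q (k + l) := by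
  induction k generalizing l with
  | zero => simp
  | succ k ihk =>
    induction l with
    | zero => simp [qBin_self]
    | succ l ihl =>
      have h1 := ihk (l + 1)
      rw [show k + 1 + (l + 1) = (k + l + 1) + 1 by ring, qBin_succ_succ,
        qShifted_succ q q (k + l + 1)]
      rw [show k + 1 + l = k + l + 1 by ring] at ihl
      rw [show k + (l + 1) = k + l + 1 by ring] at h1
      rw [qShifted_succ q q l] at h1 ⊢
      rw [qShifted_succ q q k] at ihl ⊢
      linear_combination (1 - q * q ^ k) * h1 + q ^ (k + 1) * (1 - q * q ^ l) * ihl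

theorem choose_two_succ (k : ℕ) : (k + 1).choose 2 = k + k.choose 2 := by
  rw [Nat.choose_succ_succ' k 1, Nat.choose_one_right]

/-- The `q`-binomial theorem. -/
theorem prod_add_mul_pow (q x y : R) (n : ℕ) :
    ∏ i ∈ range n, (y + x * q ^ i)
      = ∑ k ∈ range (n + 1), q ^ (k.choose 2) * qBin q n k * x ^ k * y ^ (n - k) := by
  induction n generalizing x with
  | zero => simp
  | succ n ih =>
    have e1 : ∏ i ∈ range (n + 1), (y + x * q ^ i)
        = (∏ i ∈ range n, (y + (x * q) * q ^ i)) * (y + x) := by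
      rw [Finset.prod_range_succ', pow_zero, mul_one]
      congr 1
      exact Finset.prod_congr rfl fun i _ => by ring
    rw [e1, ih, Finset.sum_range_succ' _ (n + 1), mul_add, Finset.sum_mul, Finset.sum_mul]
    have e2 : ∑ k ∈ range (n + 1), q ^ ((k + 1).choose 2) * qBin q (n + 1) (k + 1) * x ^ (k + 1) *
        y ^ (n + 1 - (k + 1)) =
        ∑ k ∈ range (n + 1), q ^ (k.choose 2) * qBin q n k * (x * q) ^ k * y ^ (n - k) * x +
        ∑ k ∈ range (n + 1), q ^ ((k + 1).choose 2) * qBin q n (k + 1) * (x * q) ^ (k + 1)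
          * y ^ (n - k) := by
      rw [← Finset.sum_add_distrib]
      refine Finset.sum_congr rfl fun k _ => ?_
      rw [qBin_succ_succ, choose_two_succ, Nat.add_sub_add_right]
      ring
    have e3 : ∑ k ∈ range (n + 1), q ^ (k.choose 2) * qBin q n k * (x * q) ^ k * y ^ (n - k) * y
        = ∑ k ∈ range (n + 1), q ^ ((k + 1).choose 2) * qBin q n (k + 1) * (x * q) ^ (k + 1)
          * y ^ (n - k) + y ^ (n + 1) := by
      rw [Finset.sum_range_succ' _ n, Finset.sum_range_succ _ n, qBin_eq_zero q n (n + 1) (by omega)]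
      simp only [mul_zero, zero_mul, add_zero, qBin_zero_right, pow_zero, mul_one, Nat.sub_zero,
        Nat.choose_zero_succ, one_mul]
      rw [← pow_succ]
      congr 1
      refine Finset.sum_congr rfl fun k hk => ?_
      rw [show n - k = n - (k + 1) + 1 by simp at hk; omega]
      ring
    rw [e2, e3]
    simp
    ring

end GaussianBinomials

theorem qBin_X_eqMod (k l : ℕ) (m : ℕ) (hk : m ≤ k) (hl : m ≤ l) :
    EqMod (m + 1) (qBin (X : ℤ⟦X⟧) (k + l) k) (iv eulerJ) := by
  have c : ∀ n, constantCoeff (qShifted (X : ℤ⟦X⟧) X n) = 1 :=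
    fun n => constantCoeff_qShifted (by simp) n
  have h := qBin_mul_qShifted (X : ℤ⟦X⟧) k l
  have e : qBin (X : ℤ⟦X⟧) (k + l) k
      = qShifted X X (k + l) * iv (qShifted X X k) * iv (qShifted X X l) := by
    rw [← h]
    linear_combination (-qBin (X : ℤ⟦X⟧) (k + l) k) * mul_iv (c k)
      - (qBin (X : ℤ⟦X⟧) (k + l) k * (qShifted X X k * iv (qShifted X X k))) * mul_iv (c l)
  rw [e]
  refine ((((qShifted_eqMod_eulerJ _).mono (by omega)).mul
    (((qShifted_eqMod_eulerJ _).mono (by omega)).iv (c _) (by simp))).mul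
    (((qShifted_eqMod_eulerJ _).mono (by omega)).iv (c _) (by simp))).trans (EqMod.of_eq ?_)
  linear_combination (iv eulerJ) * mul_iv constantCoeff_eulerJ

theorem map_qBin {R S : Type*} [CommRing R] [CommRing S] (φ : R →+* S) (q : R) :
    ∀ n k, φ (qBin q n k) = qBin (φ q) n k
  | _, 0 => by simp
  | 0, _ + 1 => by simp [qBin]
  | n + 1, k + 1 => by
    rw [qBin_succ_succ, qBin_succ_succ, map_add, map_mul, map_pow, map_qBin φ q n,
      map_qBin φ q n]

theorem qBin_X_sq_eqMod (k l : ℕ) (m : ℕ) (hk : m ≤ k) (hl : m ≤ l) :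
    EqMod (2 * (m + 1)) (qBin (X ^ 2 : ℤ⟦X⟧) (k + l) k) (iv eulerJ2) := by
  have h := (qBin_X_eqMod k l m hk hl).expand 2 two_ne_zero
  have h2 := map_qBin (expand 2 two_ne_zero : ℤ⟦X⟧ →ₐ[ℤ] ℤ⟦X⟧).toRingHom X (k + l) k
  simp only [AlgHom.toRingHom_eq_coe, RingHom.coe_coe, expand_X] at h2
  have h3 : expand 2 two_ne_zero (iv eulerJ) = iv eulerJ2 := by
    refine (map_iv (φ := (expand 2 two_ne_zero : ℤ⟦X⟧ →ₐ[ℤ] ℤ⟦X⟧).toRingHom)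
      constantCoeff_eulerJ ?_)
    exact constantCoeff_eulerJE 2 two_ne_zero
  rwa [h2, h3] at h

theorem prod_range_const_mul {R : Type*} [CommRing R] (c : R) (f : ℕ → R) (n : ℕ) :
    ∏ i ∈ range n, c * f i = c ^ n * ∏ i ∈ range n, f i := by
  rw [Finset.prod_mul_distrib, Finset.prod_const, card_range]

/-! ### Jacobi's identity for J₁³ and its consequences modulo 5. -/

section Jacobi

theorem prod_X_pow_sub (N : ℕ) : ∏ i ∈ range N, ((X : ℤ⟦X⟧) ^ N - X ^ i)
    = (-1) ^ N * X ^ (N.choose 2) * qShifted X X N := by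
  induction N with
  | zero => simp
  | succ N ih =>
    have e : ∏ i ∈ range N, ((X : ℤ⟦X⟧) ^ (N + 1) - X ^ (i + 1))
        = X ^ N * ∏ i ∈ range N, ((X : ℤ⟦X⟧) ^ N - X ^ i) := by
      rw [← prod_range_const_mul]
      exact Finset.prod_congr rfl fun i _ => by ring
    rw [Finset.prod_range_succ', e, ih, qShifted_succ, choose_two_succ]
    ring

theorem two_mul_choose_two (k : ℕ) : 2 * (k.choose 2 : ℤ) = k * (k - 1) := by
  induction k with
  | zero => simp
  | succ k ih => rw [choose_two_succ]; push_cast; linarith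

/-- A finite form of Jacobi's identity. -/
theorem qShifted_sq_eq_sum (N : ℕ) : qShifted (X : ℤ⟦X⟧) X N ^ 2
    = ∑ j ∈ range (N + 1), (-1) ^ j * X ^ ((j + 1).choose 2) *
      (((N + 1 + j : ℕ) : ℤ⟦X⟧) * qBin X (2 * N + 1) (N - j)
        - ((N - j : ℕ) : ℤ⟦X⟧) * qBin X (2 * N + 1) (N + 1 + j)) := by
  -- A finite triple product: ∏ (y - X^i) over i ≤ 2N vanishes at y = X^N, so its derivative there
  -- is the product of the other factors.
  have h := prod_add_mul_pow (Polynomial.C (X : ℤ⟦X⟧)) (-1) Polynomial.X (2 * N + 1)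
  have hd := congrArg (fun p => (Polynomial.derivative p).eval ((X : ℤ⟦X⟧) ^ N)) h
  have hl : (Polynomial.derivative (∏ i ∈ range (2 * N + 1),
      (Polynomial.X + -1 * (Polynomial.C (X : ℤ⟦X⟧)) ^ i))).eval ((X : ℤ⟦X⟧) ^ N)
      = (-1) ^ N * X ^ (N.choose 2 + N * N) * qShifted X X N ^ 2 := by
    rw [show 2 * N + 1 = (N + 1) + N by ring, Finset.prod_range_add, Finset.prod_range_succ]
    simp only [Polynomial.derivative_mul, Polynomial.eval_add, Polynomial.eval_mul,
      Polynomial.eval_prod, Polynomial.derivative_X,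
      Polynomial.eval_C, Polynomial.eval_X, Polynomial.eval_neg, Polynomial.eval_zero,
      Polynomial.eval_one, Polynomial.derivative_add, ← Polynomial.C_pow,
      Polynomial.derivative_C, Polynomial.derivative_neg, Polynomial.derivative_one]
    have e1 : ∏ i ∈ range N, ((X : ℤ⟦X⟧) ^ N + -1 * X ^ i)
        = (-1) ^ N * X ^ (N.choose 2) * qShifted X X N := by
      rw [← prod_X_pow_sub]
      exact Finset.prod_congr rfl fun i _ => by ring
    have e2 : ∏ i ∈ range N, ((X : ℤ⟦X⟧) ^ N + -1 * X ^ (N + 1 + i))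
        = X ^ (N * N) * qShifted X X N := by
      rw [qShifted_X_X, pow_mul, ← prod_range_const_mul]
      exact Finset.prod_congr rfl fun i _ => by ring
    rw [e1, e2]
    ring
  have hr : (Polynomial.derivative (∑ k ∈ range (2 * N + 1 + 1),
      (Polynomial.C (X : ℤ⟦X⟧)) ^ (k.choose 2) * qBin (Polynomial.C (X : ℤ⟦X⟧)) (2 * N + 1) k *
        (-1) ^ k * Polynomial.X ^ (2 * N + 1 - k))).eval ((X : ℤ⟦X⟧) ^ N)
      = ∑ k ∈ range (2 * N + 1 + 1), X ^ (k.choose 2) * qBin (X : ℤ⟦X⟧) (2 * N + 1) k *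
        (-1) ^ k * (((2 * N + 1 - k : ℕ) : ℤ⟦X⟧) * X ^ (N * (2 * N + 1 - k - 1))) := by
    rw [Polynomial.derivative_sum, Polynomial.eval_finsetSum]
    refine Finset.sum_congr rfl fun k _ => ?_
    have : (Polynomial.C (X : ℤ⟦X⟧)) ^ (k.choose 2) * qBin (Polynomial.C (X : ℤ⟦X⟧)) (2 * N + 1) k *
        (-1) ^ k = Polynomial.C (X ^ (k.choose 2) * qBin (X : ℤ⟦X⟧) (2 * N + 1) k * (-1) ^ k) := by
      simp [map_qBin]
    rw [this, Polynomial.derivative_C_mul_X_pow, Polynomial.eval_C_mul, Polynomial.eval_pow,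
      Polynomial.eval_X, pow_mul]
    ring
  rw [hl, hr, show 2 * N + 1 + 1 = (N + 1) + (N + 1) by ring, Finset.sum_range_add,
    ← Finset.sum_range_reflect _ (N + 1), ← Finset.sum_add_distrib] at hd
  have hne : (-1 : ℤ⟦X⟧) ^ N * X ^ (N.choose 2 + N * N) ≠ 0 :=
    mul_ne_zero (pow_ne_zero _ (by simp)) (pow_ne_zero _ X_ne_zero)
  apply mul_left_cancel₀ hne
  rw [hd, Finset.mul_sum]
  refine Finset.sum_congr rfl fun j hj => ?_
  obtain ⟨m, rfl⟩ := Nat.exists_eq_add_of_le (Nat.lt_succ_iff.1 (mem_range.1 hj))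
  have s1 : ((-1 : ℤ⟦X⟧)) ^ j * (-1) ^ j = 1 := by rw [← mul_pow]; simp
  rw [show j + m + 1 - 1 - j = m by omega, show j + m - j = m by omega,
    show 2 * (j + m) + 1 - m = j + m + 1 + j by omega,
    show j + m + 1 + j - 1 = j + m + j by omega,
    show 2 * (j + m) + 1 - (j + m + 1 + j) = m by omega]
  have x1 : m.choose 2 + (j + m) * (j + m + j)
      = (j + m).choose 2 + (j + m) * (j + m) + (j + 1).choose 2 := by
    zify
    have a := two_mul_choose_two m
    have b := two_mul_choose_two (j + m)
    have c := two_mul_choose_two (j + 1)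
    push_cast at a b c ⊢
    linarith
  -- The subtraction `m - 1` truncates at m = 0, where the factor m vanishes.
  have x2 : (m : ℤ⟦X⟧) * (X : ℤ⟦X⟧) ^ ((j + m + 1 + j).choose 2 + (j + m) * (m - 1))
      = (m : ℤ⟦X⟧) * (X : ℤ⟦X⟧) ^ ((j + m).choose 2 + (j + m) * (j + m) + (j + 1).choose 2) := by
    rcases m with _ | m
    · simp
    · rw [Nat.add_sub_cancel]
      congr 2
      zify
      have a := two_mul_choose_two (j + (m + 1) + 1 + j)
      have b := two_mul_choose_two (j + (m + 1))
      have c := two_mul_choose_two (j + 1)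
      push_cast at a b c ⊢
      linarith
  have y1 : (X : ℤ⟦X⟧) ^ (m.choose 2) * X ^ ((j + m) * (j + m + j))
      = X ^ ((j + m).choose 2 + (j + m) * (j + m)) * X ^ ((j + 1).choose 2) := by
    rw [← pow_add, x1, pow_add]
  have y2 : (m : ℤ⟦X⟧) * ((X : ℤ⟦X⟧) ^ ((j + m + 1 + j).choose 2) * X ^ ((j + m) * (m - 1)))
      = (m : ℤ⟦X⟧) * ((X : ℤ⟦X⟧) ^ ((j + m).choose 2 + (j + m) * (j + m)) * X ^ ((j + 1).choose 2)) := by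
    rw [← pow_add, x2, pow_add]
  have s2 : ((-1 : ℤ⟦X⟧)) ^ m = (-1) ^ (j + m) * (-1) ^ j := by
    rw [pow_add]
    linear_combination (-(-1) ^ m) * s1
  have s3 : ((-1 : ℤ⟦X⟧)) ^ (j + m + 1 + j) = -((-1) ^ (j + m) * (-1) ^ j) := by
    rw [pow_add, pow_add _ (j + m) 1]
    ring
  rw [s2, s3]
  linear_combination ((-1) ^ (j + m) * (-1) ^ j * qBin X (2 * (j + m) + 1) m *
    ((j + m + 1 + j : ℕ) : ℤ⟦X⟧)) * y1 - ((-1) ^ (j + m) * (-1) ^ j *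
    qBin X (2 * (j + m) + 1) (j + m + 1 + j)) * y2

/-- Jacobi's identity for `(q; q)_∞³`. -/
theorem eulerJ_cube_eqMod (N : ℕ) : EqMod (N + 1) (eulerJ ^ 3)
    (∑ j ∈ range (N + 1), (-1) ^ j * X ^ ((j + 1).choose 2) * ((2 * j + 1 : ℕ) : ℤ⟦X⟧)) := by
  have h1 := (qShifted_eqMod_eulerJ N).pow 2
  rw [qShifted_sq_eq_sum] at h1
  have h2 : EqMod (N + 1) (∑ j ∈ range (N + 1), (-1) ^ j * X ^ ((j + 1).choose 2) *
      (((N + 1 + j : ℕ) : ℤ⟦X⟧) * qBin X (2 * N + 1) (N - j)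
        - ((N - j : ℕ) : ℤ⟦X⟧) * qBin X (2 * N + 1) (N + 1 + j)))
      (∑ j ∈ range (N + 1), (-1) ^ j * X ^ ((j + 1).choose 2) * ((2 * j + 1 : ℕ) : ℤ⟦X⟧) * iv eulerJ) := by
    refine EqMod.sum fun j hj => ?_
    obtain ⟨m, rfl⟩ := Nat.exists_eq_add_of_le (Nat.lt_succ_iff.1 (mem_range.1 hj))
    have b1 := qBin_X_eqMod m (j + m + 1 + j) m (by omega) (by omega)
    have b2 := qBin_X_eqMod (j + m + 1 + j) m m (by omega) (by omega)
    rw [show m + (j + m + 1 + j) = 2 * (j + m) + 1 by ring] at b1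
    rw [show (j + m + 1 + j) + m = 2 * (j + m) + 1 by ring] at b2
    rw [show j + m - j = m by omega]
    have b3 := (((EqMod.refl _ ((j + m + 1 + j : ℕ) : ℤ⟦X⟧)).mul b1).sub
      ((EqMod.refl _ (m : ℤ⟦X⟧)).mul b2))
    have b4 := (((EqMod.refl _ ((-1) ^ j)).mul b3).X_pow_mul ((j + 1).choose 2)).mono
      (by rw [choose_two_succ]; omega : j + m + 1 ≤ _)
    refine (EqMod.of_eq (by ring)).trans (b4.trans (EqMod.of_eq ?_))
    push_cast
    ring
  have h3 := (h1.symm.trans h2).mul (EqMod.refl _ eulerJ)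
  rw [Finset.sum_mul] at h3
  refine (EqMod.of_eq (by ring)).trans (h3.trans (EqMod.of_eq ?_))
  refine Finset.sum_congr rfl fun j _ => ?_
  linear_combination ((-1) ^ j * X ^ ((j + 1).choose 2) * ((2 * j + 1 : ℕ) : ℤ⟦X⟧)) *
    mul_iv constantCoeff_eulerJ

theorem coeff_neg_one_pow_mul_X_pow (n j e c : ℕ) :
    coeff n ((-1) ^ j * X ^ e * (c : ℤ⟦X⟧)) = if n = e then (-1) ^ j * (c : ℤ) else 0 := by
  have : ((-1) ^ j * X ^ e * (c : ℤ⟦X⟧)) = C ((-1) ^ j * (c : ℤ)) * X ^ e := by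
    simp; ring
  rw [this, coeff_C_mul, coeff_X_pow]
  simp

/-- Triangular numbers are 0, 1 or 3 mod 5, and the residue 3 occurs only for j ≡ 2, exactly where
the weight 2j+1 in Jacobi's series is divisible by 5. -/
theorem choose_two_mod_five (j : ℕ) : (j + 1).choose 2 % 5 = 0 ∨ (j + 1).choose 2 % 5 = 1 ∨
    ((j + 1).choose 2 % 5 = 3 ∧ 5 ∣ 2 * j + 1) := by
  have h := two_mul_choose_two (j + 1)
  push_cast at h
  generalize (j + 1).choose 2 = t at *
  have h' : 2 * t = (j + 1) * j := by
    zify; linarith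
  have h2 : 2 * t % 5 = ((j + 1) % 5) * (j % 5) % 5 := by rw [h', Nat.mul_mod]
  have : j % 5 = 0 ∨ j % 5 = 1 ∨ j % 5 = 2 ∨ j % 5 = 3 ∨ j % 5 = 4 := by omega
  rcases this with hj | hj | hj | hj | hj <;> rw [Nat.add_mod, hj] at h2 <;>
    norm_num at h2 <;> omega

theorem coeff_eulerJ_cube_eq_zero {n : ℕ} (hn : n % 5 = 2 ∨ n % 5 = 4) :
    coeff n (eulerJ ^ 3) = 0 := by
  rw [(eulerJ_cube_eqMod n).coeff_eq (Nat.lt_succ_self n), map_sum]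
  refine Finset.sum_eq_zero fun j _ => ?_
  rw [coeff_neg_one_pow_mul_X_pow, if_neg]
  rintro rfl
  have := choose_two_mod_five j
  omega

theorem five_dvd_coeff_eulerJ_cube {n : ℕ} (hn : n % 5 = 3) :
    (5 : ℤ) ∣ coeff n (eulerJ ^ 3) := by
  rw [(eulerJ_cube_eqMod n).coeff_eq (Nat.lt_succ_self n), map_sum]
  refine Finset.dvd_sum fun j _ => ?_
  rw [coeff_neg_one_pow_mul_X_pow]
  split_ifs with h
  · subst h
    have := choose_two_mod_five j
    exact Dvd.dvd.mul_left (by exact_mod_cast (by omega : 5 ∣ 2 * j + 1)) _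
  · exact dvd_zero _

end Jacobi

/-! ### Gauss's identity for J₁²/J₂. -/

section Gauss

theorem prod_X_pow_sub_sq (M : ℕ) :
    ∏ i ∈ range (M + 1), ((X : ℤ⟦X⟧) ^ (2 * M + 1) - X ^ (2 * i))
    = (-1) ^ (M + 1) * X ^ (M * (M + 1)) * qShifted X (X ^ 2) (M + 1) := by
  induction M with
  | zero => simp [qShifted]
  | succ M ih =>
    have e : ∏ i ∈ range (M + 1), ((X : ℤ⟦X⟧) ^ (2 * (M + 1) + 1) - X ^ (2 * (i + 1)))
        = (X ^ 2) ^ (M + 1) * ∏ i ∈ range (M + 1), ((X : ℤ⟦X⟧) ^ (2 * M + 1) - X ^ (2 * i)) := by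
      rw [← prod_range_const_mul]
      exact Finset.prod_congr rfl fun i _ => by ring
    rw [Finset.prod_range_succ', e, ih, qShifted_succ X (X ^ 2) (M + 1)]
    ring

/-- A finite form of Gauss's identity. -/
theorem qShifted_odd_sq_eq_sum (M : ℕ) : qShifted (X : ℤ⟦X⟧) (X ^ 2) (M + 1) ^ 2
    = ∑ j ∈ range (M + 1), (-1) ^ (j + 1) * X ^ ((j + 1) ^ 2) * qBin (X ^ 2) (2 * M + 2) (M - j)
      + ∑ j ∈ range (M + 2), (-1) ^ j * X ^ (j ^ 2) * qBin (X ^ 2) (2 * M + 2) (M + 1 + j) := by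
  -- The value y = X^{2M+1} lies midway among the powers of X², so the product splits into two
  -- copies of (q; q²)_{M+1} up to signs and powers of X.
  have h := prod_add_mul_pow (X ^ 2 : ℤ⟦X⟧) (-1) (X ^ (2 * M + 1)) (2 * M + 2)
  have hl : ∏ i ∈ range (2 * M + 2), ((X : ℤ⟦X⟧) ^ (2 * M + 1) + -1 * (X ^ 2) ^ i)
      = (-1) ^ (M + 1) * X ^ ((3 * M + 1) * (M + 1)) * qShifted X (X ^ 2) (M + 1) ^ 2 := by
    rw [show 2 * M + 2 = (M + 1) + (M + 1) by ring, Finset.prod_range_add]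
    have e1 : ∏ i ∈ range (M + 1), ((X : ℤ⟦X⟧) ^ (2 * M + 1) + -1 * (X ^ 2) ^ i)
        = (-1) ^ (M + 1) * X ^ (M * (M + 1)) * qShifted X (X ^ 2) (M + 1) := by
      rw [← prod_X_pow_sub_sq]
      exact Finset.prod_congr rfl fun i _ => by ring
    have e2 : ∏ i ∈ range (M + 1), ((X : ℤ⟦X⟧) ^ (2 * M + 1) + -1 * (X ^ 2) ^ (M + 1 + i))
        = X ^ ((2 * M + 1) * (M + 1)) * qShifted X (X ^ 2) (M + 1) := by
      rw [qShifted, pow_mul X (2 * M + 1)]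
      rw [← prod_range_const_mul]
      exact Finset.prod_congr rfl fun i _ => by ring
    rw [e1, e2]
    ring
  have hne : (-1 : ℤ⟦X⟧) ^ (M + 1) * X ^ ((3 * M + 1) * (M + 1)) ≠ 0 :=
    mul_ne_zero (pow_ne_zero _ (by simp)) (pow_ne_zero _ X_ne_zero)
  rw [hl, show 2 * M + 2 + 1 = (M + 1) + (M + 2) by ring, Finset.sum_range_add,
    ← Finset.sum_range_reflect _ (M + 1)] at h
  apply mul_left_cancel₀ hne
  rw [h, mul_add, Finset.mul_sum, Finset.mul_sum]
  have s1 : ∀ j, ((-1 : ℤ⟦X⟧)) ^ j * (-1) ^ j = 1 := fun j => by rw [← mul_pow]; simp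
  congr 1
  · refine Finset.sum_congr rfl fun j hj => ?_
    obtain ⟨m, rfl⟩ := Nat.exists_eq_add_of_le (Nat.lt_succ_iff.1 (mem_range.1 hj))
    rw [show j + m + 1 - 1 - j = m by omega, show j + m - j = m by omega,
      show 2 * (j + m) + 2 - m = 2 * j + m + 2 by omega]
    have x1 : 2 * m.choose 2 + (2 * (j + m) + 1) * (2 * j + m + 2)
        = (3 * (j + m) + 1) * (j + m + 1) + (j + 1) ^ 2 := by
      zify
      have a := two_mul_choose_two m
      linear_combination a
    have y1 : ((X : ℤ⟦X⟧) ^ 2) ^ (m.choose 2) * (X ^ (2 * (j + m) + 1)) ^ (2 * j + m + 2)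
        = X ^ ((3 * (j + m) + 1) * (j + m + 1)) * X ^ ((j + 1) ^ 2) := by
      rw [← pow_mul, ← pow_mul, ← pow_add, x1, pow_add]
    have s2 : ((-1 : ℤ⟦X⟧)) ^ m = (-1) ^ (j + m + 1) * (-1) ^ (j + 1) := by
      rw [pow_add, pow_add, pow_add _ j 1]
      linear_combination (-(-1) ^ m) * s1 j
    rw [s2]
    linear_combination ((-1) ^ (j + m + 1) * (-1) ^ (j + 1) *
      qBin (X ^ 2) (2 * (j + m) + 2) m) * y1
  · refine Finset.sum_congr rfl fun j hj => ?_
    obtain ⟨m, hm⟩ := Nat.exists_eq_add_of_le (Nat.lt_succ_iff.1 (mem_range.1 hj))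
    have x1 : 2 * (M + 1 + j).choose 2 + (2 * M + 1) * m = (3 * M + 1) * (M + 1) + j ^ 2 := by
      have hm' : (M : ℤ) + 1 = j + m := by exact_mod_cast hm
      zify
      have a := two_mul_choose_two (M + 1 + j)
      push_cast at a
      linear_combination a - (2 * (M : ℤ) + 1) * hm'
    have y1 : ((X : ℤ⟦X⟧) ^ 2) ^ ((M + 1 + j).choose 2) * (X ^ (2 * M + 1)) ^ m
        = X ^ ((3 * M + 1) * (M + 1)) * X ^ (j ^ 2) := by
      rw [← pow_mul, ← pow_mul, ← pow_add, x1, pow_add]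
    rw [show 2 * M + 2 - (M + 1 + j) = m by omega, pow_add _ (M + 1) j]
    linear_combination ((-1) ^ (M + 1) * (-1) ^ j *
      qBin (X ^ 2) (2 * M + 2) (M + 1 + j)) * y1

/-- Gauss's identity for `(q; q)_∞² / (q²; q²)_∞`. -/
theorem eulerJ_sq_div_eqMod (M : ℕ) : EqMod (2 * M + 2) (eulerJ ^ 2 * iv eulerJ2)
    (∑ j ∈ range (M + 1), (-1) ^ (j + 1) * X ^ ((j + 1) ^ 2) * ((1 : ℕ) : ℤ⟦X⟧)
      + ∑ j ∈ range (M + 2), (-1) ^ j * X ^ (j ^ 2) * ((1 : ℕ) : ℤ⟦X⟧)) := by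
  have h1 := ((qShifted_odd_eqMod (M + 1)).mono (by omega : 2 * M + 2 ≤ _)).pow 2
  rw [qShifted_odd_sq_eq_sum] at h1
  have h2 : EqMod (2 * M + 2)
      (∑ j ∈ range (M + 1), (-1) ^ (j + 1) * X ^ ((j + 1) ^ 2) * qBin (X ^ 2) (2 * M + 2) (M - j)
      + ∑ j ∈ range (M + 2), (-1) ^ j * X ^ (j ^ 2) * qBin (X ^ 2) (2 * M + 2) (M + 1 + j))
      ((∑ j ∈ range (M + 1), (-1) ^ (j + 1) * X ^ ((j + 1) ^ 2) * ((1 : ℕ) : ℤ⟦X⟧)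
      + ∑ j ∈ range (M + 2), (-1) ^ j * X ^ (j ^ 2) * ((1 : ℕ) : ℤ⟦X⟧)) * iv eulerJ2) := by
    rw [add_mul, Finset.sum_mul, Finset.sum_mul]
    refine EqMod.add (EqMod.sum fun j hj => ?_) (EqMod.sum fun j hj => ?_)
    · obtain ⟨m, rfl⟩ := Nat.exists_eq_add_of_le (Nat.lt_succ_iff.1 (mem_range.1 hj))
      have b1 := qBin_X_sq_eqMod m (2 * j + m + 2) m (by omega) (by omega)
      rw [show m + (2 * j + m + 2) = 2 * (j + m) + 2 by ring] at b1
      rw [show j + m - j = m by omega]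
      have b4 := (((EqMod.refl _ ((-1) ^ (j + 1))).mul b1).X_pow_mul ((j + 1) ^ 2)).mono
        (by nlinarith : 2 * (j + m) + 2 ≤ _)
      refine (EqMod.of_eq (by ring)).trans (b4.trans (EqMod.of_eq ?_))
      push_cast
      ring
    · obtain ⟨m, hm⟩ := Nat.exists_eq_add_of_le (Nat.lt_succ_iff.1 (mem_range.1 hj))
      have b1 := qBin_X_sq_eqMod (M + 1 + j) m m (by omega) (by omega)
      rw [show M + 1 + j + m = 2 * M + 2 by omega] at b1
      have b4 := (((EqMod.refl _ ((-1) ^ j)).mul b1).X_pow_mul (j ^ 2)).mono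
        (by nlinarith [sq_nonneg ((j : ℤ) - 1), Nat.le_self_pow two_ne_zero j] : 2 * M + 2 ≤ _)
      refine (EqMod.of_eq (by ring)).trans (b4.trans (EqMod.of_eq ?_))
      push_cast
      ring
  have h3 := (h1.symm.trans h2).mul (EqMod.refl _ eulerJ2)
  have i2 : eulerJ2 * iv eulerJ2 = 1 := mul_iv (by simp)
  refine (EqMod.of_eq ?_).trans (h3.trans (EqMod.of_eq ?_))
  · linear_combination (-eulerJ ^ 2 * iv eulerJ2) * i2
  · linear_combination (∑ j ∈ range (M + 1), (-1) ^ (j + 1) * X ^ ((j + 1) ^ 2) * ((1 : ℕ) : ℤ⟦X⟧)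
      + ∑ j ∈ range (M + 2), (-1) ^ j * X ^ (j ^ 2) * ((1 : ℕ) : ℤ⟦X⟧)) * i2

theorem sq_mod_five (j : ℕ) : j ^ 2 % 5 = 0 ∨ j ^ 2 % 5 = 1 ∨ j ^ 2 % 5 = 4 := by
  have : j % 5 = 0 ∨ j % 5 = 1 ∨ j % 5 = 2 ∨ j % 5 = 3 ∨ j % 5 = 4 := by omega
  rcases this with hj | hj | hj | hj | hj <;> simp [Nat.pow_mod, hj]

theorem coeff_eulerJ_sq_div_eq_zero {n : ℕ} (hn : n % 5 = 2 ∨ n % 5 = 3) :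
    coeff n (eulerJ ^ 2 * iv eulerJ2) = 0 := by
  rw [(eulerJ_sq_div_eqMod n).coeff_eq (by omega), map_add, map_sum, map_sum,
    Finset.sum_eq_zero, Finset.sum_eq_zero, add_zero]
  · intro j _
    rw [coeff_neg_one_pow_mul_X_pow, if_neg]
    rintro rfl
    have := sq_mod_five j
    omega
  · intro j _
    rw [coeff_neg_one_pow_mul_X_pow, if_neg]
    rintro rfl
    have := sq_mod_five (j + 1)
    omega

end Gauss

/-! ### The derivation θ = X d/dX. -/

section theta

variable {R : Type*} [CommRing R]

/-- The derivation `X d/dX` on power series. -/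
noncomputable def theta (R : Type*) [CommRing R] : Derivation R R⟦X⟧ R⟦X⟧ :=
  (X : R⟦X⟧) • derivative R

theorem coeff_theta (n : ℕ) (f : R⟦X⟧) : coeff n (theta R f) = n * coeff n f := by
  change coeff n (X * derivative R f) = _
  cases n with
  | zero => simp
  | succ n => rw [coeff_succ_X_mul, coeff_derivative]; push_cast; ring

theorem theta_mul (f g : R⟦X⟧) : theta R (f * g) = theta R f * g + f * theta R g := by
  rw [Derivation.leibniz, smul_eq_mul, smul_eq_mul]; ring

theorem theta_pow_succ (f : R⟦X⟧) (n : ℕ) :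
    theta R (f ^ (n + 1)) = (n + 1 : R⟦X⟧) * f ^ n * theta R f := by
  rw [Derivation.leibniz_pow, smul_eq_mul, nsmul_eq_mul]
  push_cast
  ring

theorem theta_ofNat (n : ℕ) [n.AtLeastTwo] : theta R (OfNat.ofNat n) = 0 := by
  rw [← Nat.cast_ofNat]; exact Derivation.map_natCast _ _

theorem theta_map {S : Type*} [CommRing S] (φ : R →+* S) (f : R⟦X⟧) :
    theta S (map φ f) = map φ (theta R f) := by
  ext n; simp [coeff_theta]

theorem theta_expand (p : ℕ) (hp : p ≠ 0) (f : R⟦X⟧) :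
    theta R (expand p hp f) = p * expand p hp (theta R f) := by
  ext n
  have : (p : R⟦X⟧) = C (p : R) := by simp
  rw [coeff_theta, this, coeff_C_mul]
  by_cases h : p ∣ n
  · obtain ⟨m, rfl⟩ := h
    rw [coeff_expand_mul, coeff_expand_mul, coeff_theta]; push_cast; ring
  · rw [coeff_expand_of_not_dvd _ _ _ h, coeff_expand_of_not_dvd _ _ _ h]; simp

end theta

/-! ### Differential equations modulo 5. -/

instance fact_prime_five : Fact (Nat.Prime 5) := ⟨by norm_num⟩

instance charP_five : CharP (ZMod 5)⟦X⟧ 5 :=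
  charP_of_injective_ringHom (f := (C : ZMod 5 →+* (ZMod 5)⟦X⟧)) C_injective 5

theorem nat_five_ne_zero : (5 : ℕ) ≠ 0 := by norm_num

/-- Frobenius fixes the coefficients in 𝔽₅. -/
theorem expand_five (f : (ZMod 5)⟦X⟧) : expand 5 nat_five_ne_zero f = f ^ 5 := by
  have := MvPowerSeries.map_frobenius_expand (R := ZMod 5) (σ := Unit) 5 (by norm_num) (f := f)
  rw [ZMod.frobenius_zmod] at this
  rw [← this]; simp [expand]

/-- Reduction modulo `5`. -/
noncomputable abbrev redFive : ℤ⟦X⟧ →+* (ZMod 5)⟦X⟧ := map (Int.castRingHom (ZMod 5))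

theorem redFive_expand (p : ℕ) (hp : p ≠ 0) (f : ℤ⟦X⟧) :
    redFive (expand p hp f) = expand p hp (redFive f) := map_expand _ _ _ _

local notation "θ" => theta (ZMod 5)
local notation "E₂" => expand (R := ZMod 5) 2 two_ne_zero

/-- `(q; q)_∞` modulo `5`. -/
noncomputable def jBar : (ZMod 5)⟦X⟧ := redFive eulerJ

/-- `(q²; q²)_∞` modulo `5`. -/
noncomputable def jBar2 : (ZMod 5)⟦X⟧ := E₂ jBar

/-- `1 - θ(J) / J` modulo `5`, a reduced Eisenstein series of weight two. -/
noncomputable def logA : (ZMod 5)⟦X⟧ := 1 - θ jBar * redFive (iv eulerJ)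

/-- The series `logA` at `q²`. -/
noncomputable def logB : (ZMod 5)⟦X⟧ := E₂ logA

theorem redFive_eulerJ2 : redFive eulerJ2 = jBar2 := redFive_expand _ _ _

theorem constantCoeff_jBar : constantCoeff jBar = 1 := by
  rw [← coeff_zero_eq_constantCoeff_apply, jBar, coeff_map, coeff_zero_eq_constantCoeff_apply]
  simp

theorem ne_zero_of_constantCoeff {f : (ZMod 5)⟦X⟧} (h : constantCoeff f ≠ 0) : f ≠ 0 := by
  rintro rfl; simp at h

theorem jBar_ne_zero : jBar ≠ 0 := ne_zero_of_constantCoeff (by simp [constantCoeff_jBar])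

theorem constantCoeff_jBar2 : constantCoeff jBar2 = 1 := by
  simp [jBar2, constantCoeff_jBar]

theorem jBar2_ne_zero : jBar2 ≠ 0 := ne_zero_of_constantCoeff (by simp [constantCoeff_jBar2])

theorem theta_jBar : θ jBar = (1 - logA) * jBar := by
  have : jBar * redFive (iv eulerJ) = 1 := by
    rw [jBar, ← map_mul, mul_iv (by simp), map_one]
  rw [logA]; linear_combination (- θ jBar) * this

theorem theta_E (f : (ZMod 5)⟦X⟧) : θ (E₂ f) = 2 * E₂ (θ f) := by
  rw [theta_expand]; norm_num

theorem theta_jBar2 : θ jBar2 = 2 * (1 - logB) * jBar2 := by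
  rw [jBar2, theta_E, theta_jBar, map_mul, map_sub, map_one, logB]; ring

theorem constantCoeff_theta (f : (ZMod 5)⟦X⟧) : constantCoeff (θ f) = 0 := by
  rw [← coeff_zero_eq_constantCoeff_apply, coeff_theta]; simp

theorem constantCoeff_logA : constantCoeff logA = 1 := by
  simp [logA, constantCoeff_theta]

theorem constantCoeff_logB : constantCoeff logB = 1 := by
  simp [logB, constantCoeff_logA]

theorem natCast_zmod_five_cases (n : ℕ) (r : ℕ) (h : n % 5 = r) : (n : ZMod 5) = r := by
  rw [← h, ZMod.natCast_mod]

/-- Modulo 5, J₁³ lives on exponents 0 and 1 mod 5 by Jacobi, and n² = n there. So θ² = θ on J₁³;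
dividing by J₁³ leaves a Riccati equation. -/
theorem theta_logA : θ logA = 3 * (logA ^ 2 - 1) := by
  have key : θ (θ (jBar ^ 3)) = θ (jBar ^ 3) := by
    ext n
    rw [coeff_theta, coeff_theta, jBar, ← map_pow, coeff_map]
    have : n % 5 < 5 := Nat.mod_lt _ (by norm_num)
    have h : n % 5 = 0 ∨ n % 5 = 1 ∨ (n % 5 = 2 ∨ n % 5 = 4) ∨ n % 5 = 3 := by omega
    rcases h with h | h | h | h
    · rw [natCast_zmod_five_cases _ _ h]; simp
    · rw [natCast_zmod_five_cases _ _ h]; simp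
    · rw [coeff_eulerJ_cube_eq_zero h]; simp
    · have h0 := (ZMod.intCast_zmod_eq_zero_iff_dvd _ 5).2 (five_dvd_coeff_eulerJ_cube h)
      rw [eq_intCast, h0]; simp
  have h1 : θ (jBar ^ 3) = 3 * (1 - logA) * jBar ^ 3 := by
    rw [theta_pow_succ, theta_jBar]; push_cast; ring
  have h2 : θ (θ (jBar ^ 3)) = (9 * (1 - logA) ^ 2 - 3 * θ logA) * jBar ^ 3 := by
    rw [h1, theta_mul, theta_mul, h1, map_sub, theta_ofNat, Derivation.map_one_eq_zero]; ring
  rw [h2, h1] at key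
  have := mul_right_cancel₀ (pow_ne_zero 3 jBar_ne_zero) key
  grind

theorem theta_logB : θ logB = logB ^ 2 - 1 := by
  rw [logB, theta_E, theta_logA]
  simp only [map_mul, map_sub, map_pow, map_one, map_ofNat]
  grind

/-- By Gauss, J₁²/J₂ lives on exponents 0, ±1 mod 5, where n³ = n. So θ³ = θ on it, and the Riccati
equations turn this into an algebraic relation. -/
theorem cubic_relation : 4 * logB ^ 3 + 2 * logA ^ 3 + 4 * logA * logB ^ 2 + 3 * logA ^ 2 * logB
    + 4 * logA - 2 * logB = 0 := by
  obtain ⟨p, hp⟩ : ∃ p, p = redFive (eulerJ ^ 2 * iv eulerJ2) := ⟨_, rfl⟩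
  have key : θ (θ (θ p)) = θ p := by
    ext n
    rw [coeff_theta, coeff_theta, coeff_theta, hp, coeff_map]
    have : n % 5 < 5 := Nat.mod_lt _ (by norm_num)
    have h : n % 5 = 0 ∨ n % 5 = 1 ∨ (n % 5 = 2 ∨ n % 5 = 3) ∨ n % 5 = 4 := by omega
    rcases h with h | h | h | h
    · rw [natCast_zmod_five_cases _ _ h]; simp
    · rw [natCast_zmod_five_cases _ _ h]; simp
    · rw [coeff_eulerJ_sq_div_eq_zero h]; simp
    · rw [natCast_zmod_five_cases _ _ h, ← mul_assoc, ← mul_assoc]; congr 1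
  have hpj : p * jBar2 = jBar ^ 2 := by
    rw [hp, ← redFive_eulerJ2, ← map_mul, mul_assoc, mul_comm (iv _), mul_iv (by simp), mul_one,
      map_pow, jBar]
  have hp0 : p ≠ 0 := by
    rintro rfl
    exact pow_ne_zero 2 jBar_ne_zero (by rw [← hpj, zero_mul])
  have h1 : θ p = 2 * (logB - logA) * p := by
    have := congrArg θ hpj
    rw [theta_mul, theta_pow_succ, theta_jBar, theta_jBar2] at this
    apply mul_right_cancel₀ jBar2_ne_zero
    push_cast at this
    linear_combination this - 2 * (1 - logA) * hpj
  have h2 : θ (θ p) = (logB ^ 2 + 3 * logA ^ 2 + 2 * logA * logB - 1) * p := by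
    rw [h1, theta_mul, theta_mul, h1, map_sub, theta_ofNat, theta_logA, theta_logB]; grind
  have t2 : θ 2 = 0 := theta_ofNat 2
  have t3 : θ 3 = 0 := theta_ofNat 3
  have h3 : θ (θ (θ p)) = ((2 * logB * (logB ^ 2 - 1) + 18 * logA * (logA ^ 2 - 1) +
      6 * (logA ^ 2 - 1) * logB + 2 * logA * (logB ^ 2 - 1)) +
      (logB ^ 2 + 3 * logA ^ 2 + 2 * logA * logB - 1) * (2 * (logB - logA))) * p := by
    rw [h2, theta_mul, h1]
    simp only [map_sub, map_add, theta_mul, t2, t3, Derivation.map_one_eq_zero,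
      theta_logA, theta_logB, pow_two]
    ring
  rw [h3, h1] at key
  have := mul_right_cancel₀ hp0 key
  grind

/-- A series of which both `logA` and `logB` are polynomials. -/
noncomputable def modE : (ZMod 5)⟦X⟧ := 2 * logB - logA

/-- Substituting `logA = 2 * logB - modE` in the cubic relation cancels every nonlinear term
containing `logB` modulo 5. The relation becomes linear in `logB`, so `modE` parametrises the curve.
-/
theorem logA_eq : logA = -modE ^ 3 + 2 * modE := by
  have := cubic_relation
  rw [modE]; grind

theorem logB_eq : logB = 2 * modE ^ 3 - modE := by
  have := cubic_relation
  rw [modE]; grind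

theorem theta_modE : θ modE = 1 - modE ^ 4 := by
  have h : θ modE = 2 * (logB ^ 2 - 1) - 3 * (logA ^ 2 - 1) := by
    rw [modE, map_sub, theta_mul, theta_logA, theta_logB, theta_ofNat]; ring
  rw [h, logA_eq, logB_eq]; grind

theorem constantCoeff_modE : constantCoeff modE = 1 := by
  simp [modE, constantCoeff_logA, constantCoeff_logB]; rfl

/-! ### Pentagonal numbers modulo 5 and products in terms of E. -/

theorem exists_eq_of_pentagonal_eq {k : ℤ} {t : ℕ} (hk : pentagonal k = 5 * t + 1) :
    ∃ l : ℤ, k = 5 * l + 1 := by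
  have h2 := two_mul_natCast_pentagonal k
  rw [hk] at h2
  push_cast at h2
  have h3 : (5 : ℤ) ∣ (k - 1) := by
    have : (5 : ℤ) ∣ 3 * (k * (3 * k - 1) - 2) := ⟨6 * t, by rw [← h2]; ring⟩
    have h4 : (5 : ℤ) ∣ (k - 1) ^ 2 := by
      rw [show (k - 1) ^ 2 = -(3 * (k * (3 * k - 1) - 2)) + 5 * (2 * k ^ 2 - k - 1) by ring]
      exact dvd_add (by rwa [dvd_neg]) (dvd_mul_right _ _)
    exact Int.Prime.dvd_pow' (p := 5) (by norm_num) h4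
  obtain ⟨l, hl⟩ := h3
  exact ⟨l, by linarith⟩

theorem pentagonal_five_mul_add_one (l : ℤ) :
    pentagonal (5 * l + 1) = 25 * pentagonal (-l) + 1 := by
  have h1 := two_mul_natCast_pentagonal (5 * l + 1)
  have h2 := two_mul_natCast_pentagonal (-l)
  zify
  apply mul_left_cancel₀ (two_ne_zero : (2 : ℤ) ≠ 0)
  linear_combination h1 - 25 * h2

theorem coeff_eulerJ_of_not_dvd {t : ℕ} (ht : ¬ 5 ∣ t) : coeff (5 * t + 1) eulerJ = 0 := by
  apply coeff_pentagonalSeries_eq_zero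
  rintro ⟨k, hk⟩
  obtain ⟨l, rfl⟩ := exists_eq_of_pentagonal_eq hk
  rw [pentagonal_five_mul_add_one] at hk
  omega

/-- Pentagonal numbers congruent to 1 mod 5 have index 5l+1 and equal 25 times the pentagonal number
of -l, plus 1; the sign changes because (-1)^{5l+1} = -(-1)^l. -/
theorem coeff_eulerJ_twentyfive_mul (u : ℕ) : coeff (25 * u + 1) eulerJ = - coeff u eulerJ := by
  by_cases hu : u ∈ Set.range pentagonal
  · obtain ⟨l, rfl⟩ := hu
    have := pentagonal_five_mul_add_one (-l)
    rw [neg_neg] at this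
    rw [← this, eulerJ, coeff_pentagonalSeries_pentagonal, coeff_pentagonalSeries_pentagonal,
      Int.negOnePow_succ, mul_neg, Int.negOnePow_neg, show 5 * l = 2 * (2 * l) + l by ring,
      Int.negOnePow_add, Int.negOnePow_even _ (even_two_mul _), one_mul]
    simp
  · rw [eulerJ, coeff_pentagonalSeries_eq_zero _ hu, neg_zero]
    apply coeff_pentagonalSeries_eq_zero
    rintro ⟨k, hk⟩
    apply hu
    obtain ⟨l, rfl⟩ := exists_eq_of_pentagonal_eq (k := k) (t := 5 * u) (by omega)
    rw [pentagonal_five_mul_add_one] at hk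
    exact ⟨-l, by omega⟩

theorem coeff_sub_theta (n : ℕ) (f : (ZMod 5)⟦X⟧) :
    coeff n (f - θ f) = (1 - n) * coeff n f := by
  rw [map_sub, coeff_theta]; ring

theorem zmod_five_pow_four {x : ZMod 5} (hx : x ≠ 0) : x ^ 4 = 1 := ZMod.pow_card_sub_one_eq_one hx

/-- The operator 1 - θ multiplies the n-th coefficient by 1 - n, so by Fermat its fourth power
removes exactly the exponents 1 mod 5. In J₁ that part is -X J₁(q²⁵) = -X J₁²⁵, while the Riccati
equation computes (1 - θ)⁴ J₁ as a multiple of J₁. -/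
theorem X_mul_jBar_pow : X * jBar ^ 24 = 2 * (1 - logA ^ 2) := by
  have hD1 : jBar - θ jBar = logA * jBar := by rw [theta_jBar]; ring
  have hD2 : logA * jBar - θ (logA * jBar) = (3 - 2 * logA ^ 2) * jBar := by
    rw [theta_mul, theta_jBar, theta_logA]; ring
  have hD3 : (3 - 2 * logA ^ 2) * jBar - θ ((3 - 2 * logA ^ 2) * jBar) = logA * jBar := by
    rw [theta_mul, map_sub, theta_mul, theta_pow_succ, theta_ofNat, theta_ofNat, theta_jBar,
      theta_logA]
    grind
  have key : jBar - (3 - 2 * logA ^ 2) * jBar = -(X * jBar ^ 25) := by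
    have hE : jBar ^ 25 = expand 5 nat_five_ne_zero (expand 5 nat_five_ne_zero jBar) := by
      rw [expand_five, expand_five]; ring
    rw [hE]
    ext n
    have hc : coeff n ((3 - 2 * logA ^ 2) * jBar) = (1 - n) ^ 4 * coeff n jBar := by
      rw [← hD2, coeff_sub_theta, ← hD3, coeff_sub_theta, ← hD2, coeff_sub_theta, ← hD1,
        coeff_sub_theta]
      ring
    rw [map_sub, hc, map_neg]
    by_cases hn : (n : ZMod 5) = 1
    · obtain ⟨t, rfl⟩ : ∃ t, n = 5 * t + 1 := by
        have : (n : ZMod 5) = (1 : ℕ) := by simpa using hn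
        rw [ZMod.natCast_eq_natCast_iff'] at this
        exact ⟨n / 5, by omega⟩
      rw [hn, coeff_succ_X_mul, coeff_expand_mul, jBar, coeff_map]
      by_cases ht : 5 ∣ t
      · obtain ⟨u, rfl⟩ := ht
        rw [coeff_expand_mul, show 5 * (5 * u) + 1 = 25 * u + 1 by ring, coeff_eulerJ_twentyfive_mul, coeff_map]
        simp
      · rw [coeff_expand_of_not_dvd _ _ _ ht, coeff_eulerJ_of_not_dvd ht]
        simp
    · have h4 : (1 - n : ZMod 5) ^ 4 = 1 := zmod_five_pow_four (sub_ne_zero.2 (Ne.symm hn))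
      rw [h4, one_mul, sub_self]
      cases n with
      | zero => simp
      | succ m =>
        have : ¬ 5 ∣ m := by
          intro h
          apply hn
          rw [Nat.cast_succ, (ZMod.natCast_eq_zero_iff _ _).2 h, zero_add]
        rw [coeff_succ_X_mul, coeff_expand_of_not_dvd _ _ _ this, neg_zero]
  apply mul_right_cancel₀ jBar_ne_zero
  linear_combination key

theorem X_mul_jBar2_pow : X ^ 2 * jBar2 ^ 24 = 2 * (1 - logB ^ 2) := by
  have := congrArg E₂ X_mul_jBar_pow
  simpa only [jBar2, logB, map_mul, map_sub, map_pow, map_one, map_ofNat, expand_X] using this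

/-- The cubes agree, by the formulas for X J₁²⁴ and X² J₂²⁴. The cube root is unique because 𝔽₅ has
no primitive cube root of unity. -/
theorem X_mul_jBar_mul_jBar2 : X * jBar ^ 8 * jBar2 ^ 8 = modE ^ 4 - 1 := by
  obtain ⟨y, hy⟩ : ∃ y, y = X * jBar ^ 8 * jBar2 ^ 8 := ⟨_, rfl⟩
  obtain ⟨z, hz⟩ : ∃ z, z = modE ^ 4 - 1 := ⟨_, rfl⟩
  rw [← hy, ← hz]
  have hcube : y ^ 3 = z ^ 3 := by
    have h : y ^ 3 = (X * jBar ^ 24) * (X ^ 2 * jBar2 ^ 24) := by rw [hy]; ring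
    rw [h, X_mul_jBar_pow, X_mul_jBar2_pow, logA_eq, logB_eq, hz]
    grind
  have hXy : y = X * (jBar ^ 8 * jBar2 ^ 8) := by rw [hy]; ring
  obtain ⟨v, hv⟩ : (X : (ZMod 5)⟦X⟧) ∣ z := by
    rw [X_dvd_iff, hz]; simp [constantCoeff_modE]
  obtain ⟨u, hu⟩ : ∃ u, u = jBar ^ 8 * jBar2 ^ 8 := ⟨_, rfl⟩
  have hu1 : constantCoeff u = 1 := by simp [hu, constantCoeff_jBar, constantCoeff_jBar2]
  rw [hXy, ← hu, hv] at hcube ⊢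
  have h3 : (u - v) * (u ^ 2 + u * v + v ^ 2) = 0 := by
    apply mul_left_cancel₀ (pow_ne_zero 3 (X_ne_zero (R := ZMod 5)))
    linear_combination hcube
  have h4 : u ^ 2 + u * v + v ^ 2 ≠ 0 := by
    apply ne_zero_of_constantCoeff
    simp only [map_add, map_mul, map_pow, hu1]
    generalize constantCoeff v = c
    -- It remains that 1 + c + c² has no zero in 𝔽₅.
    revert c; decide
  rw [sub_eq_zero.1 ((mul_eq_zero.1 h3).resolve_right h4)]

/-! ### The correction S in J₁⁵ = J₁(q⁵)(1 - 5S). -/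

theorem theta_pow_five (f : (ZMod 5)⟦X⟧) : θ (f ^ 5) = 0 := by
  rw [← expand_five, theta_expand, CharP.cast_eq_zero, zero_mul]

theorem exists_five_mul_of_redFive_eq_zero {f : ℤ⟦X⟧} (h : redFive f = 0) : ∃ g, f = 5 * g := by
  have hd : ∀ n, (5 : ℤ) ∣ coeff n f := by
    intro n
    have := congrArg (coeff n) h
    rw [coeff_map, map_zero] at this
    exact (ZMod.intCast_zmod_eq_zero_iff_dvd _ 5).1 this
  choose c hc using hd
  refine ⟨mk c, ?_⟩
  ext n
  have : (5 : ℤ⟦X⟧) = C (5 : ℤ) := by simp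
  rw [this, coeff_C_mul, coeff_mk, hc]

theorem exists_eulerJ_pow_five :
    ∃ S : ℤ⟦X⟧, eulerJ ^ 5 = expand 5 nat_five_ne_zero eulerJ * (1 - 5 * S) := by
  obtain ⟨D, hD⟩ := exists_five_mul_of_redFive_eq_zero
    (f := expand 5 nat_five_ne_zero eulerJ - eulerJ ^ 5)
    (by rw [map_sub, redFive_expand, expand_five, map_pow, sub_self])
  have h := mul_iv (f := expand 5 nat_five_ne_zero eulerJ) (by simp)
  exact ⟨D * iv (expand 5 nat_five_ne_zero eulerJ), by linear_combination -hD + 5 * D * h⟩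

/-- Differentiating over ℤ makes every term divisible by 5; the 5 is cancelled before reduction. The
fifth power of `logA` comes from the logarithmic derivative at q⁵. -/
theorem theta_redFive_of_eulerJ_pow_five {S : ℤ⟦X⟧}
    (hS : eulerJ ^ 5 = expand 5 nat_five_ne_zero eulerJ * (1 - 5 * S)) :
    θ (redFive S) = logA - logA ^ 5 := by
  have h : eulerJ ^ 4 * theta ℤ eulerJ = expand 5 nat_five_ne_zero (theta ℤ eulerJ) * (1 - 5 * S)
      - expand 5 nat_five_ne_zero eulerJ * theta ℤ S := by
    have := congrArg (theta ℤ) hS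
    rw [theta_pow_succ, theta_mul, theta_expand, map_sub, theta_mul, Derivation.map_one_eq_zero,
      theta_ofNat] at this
    have h5 : (5 : ℤ⟦X⟧) ≠ 0 := fun h => by
      have := congrArg constantCoeff h
      rw [map_ofNat, map_zero] at this
      norm_num at this
    apply mul_left_cancel₀ h5
    push_cast at this
    linear_combination this
  have h2 := congrArg redFive h
  simp only [map_mul, map_sub, map_pow, map_one, map_ofNat, redFive_expand, expand_five,
    ← theta_map] at h2
  rw [← jBar, theta_jBar] at h2
  apply mul_left_cancel₀ (pow_ne_zero 5 jBar_ne_zero)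
  grind

/-- The series `X J³ J₂³` modulo `5`. -/
noncomputable def gBar : (ZMod 5)⟦X⟧ := X * jBar ^ 3 * jBar2 ^ 3

theorem theta_X : θ X = X := by
  ext n
  rw [coeff_theta, coeff_X]
  split_ifs with h <;> simp [h]

theorem theta_gBar : θ gBar = modE ^ 3 * gBar := by
  rw [gBar, theta_mul, theta_mul, theta_pow_succ, theta_pow_succ, theta_X, theta_jBar,
    theta_jBar2, logA_eq, logB_eq]
  push_cast
  grind

theorem theta_theta_gBar : θ (θ gBar) = (3 * modE ^ 2 - 2 * modE ^ 6) * gBar := by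
  rw [theta_gBar, theta_mul, theta_pow_succ, theta_modE, theta_gBar]; push_cast; ring

theorem theta_three_gBar : θ (θ (θ gBar)) = modE * gBar := by
  rw [theta_theta_gBar, theta_mul, map_sub, theta_mul, theta_mul, theta_pow_succ, theta_pow_succ,
    theta_modE, theta_gBar, theta_ofNat, theta_ofNat]
  push_cast; grind

/-- Consequently, in θ⁴(g t) the one term with t undifferentiated is g t itself, so g t - θ⁴(g t)
involves t only through its derivatives. -/
theorem theta_four_gBar : θ (θ (θ (θ gBar))) = gBar := by
  rw [theta_three_gBar, theta_mul, theta_modE, theta_gBar]; ring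

/-- The derivatives of t are polynomials in E, so the left side is g times such a polynomial. The
right side is X⁵J₁³⁵J₂³⁵ = (X J₁⁸J₂⁸)⁴ g = (E⁴ - 1)⁴ g. -/
theorem sub_theta_four_gBar_mul {t : (ZMod 5)⟦X⟧}
    (ht : θ t = (modE ^ 3 - modE) ^ 5 - (modE ^ 3 - modE)) :
    gBar * t - θ (θ (θ (θ (gBar * t)))) = expand 5 nat_five_ne_zero (X * jBar ^ 7 * jBar2 ^ 7) := by
  have hL : θ (θ (θ (θ (gBar * t)))) = θ (θ (θ (θ gBar))) * t + 4 * (θ (θ (θ gBar)) * θ t) +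
      6 * (θ (θ gBar) * θ (θ t)) + 4 * (θ gBar * θ (θ (θ t))) + gBar * θ (θ (θ (θ t))) := by
    simp only [theta_mul, map_add]; ring
  have t2 : θ 2 = 0 := theta_ofNat 2
  have t3 : θ 3 = 0 := theta_ofNat 3
  have t4 : θ 4 = 0 := theta_ofNat 4
  have h2 : θ (θ t) = 4 * (modE ^ 2 * 3 + 4) * (1 - modE ^ 4) := by
    rw [ht, map_sub, theta_pow_five, map_sub, theta_pow_succ, theta_modE]
    push_cast; grind
  have h2' : θ (θ t) = 1 + 2 * modE ^ 2 + 4 * modE ^ 4 + 3 * modE ^ 6 := by rw [h2]; grind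
  have h3 : θ (θ (θ t)) = 4 * modE + modE ^ 3 + 4 * modE ^ 5 + 4 * modE ^ 7 + 2 * modE ^ 9 := by
    rw [h2']
    simp only [map_add, theta_mul, theta_pow_succ, theta_modE, Derivation.map_one_eq_zero, t2, t3, t4]
    push_cast; grind
  have h4 : θ (θ (θ (θ t))) = 4 + 3 * modE ^ 2 + modE ^ 4 + 3 * modE ^ 8 + 2 * modE ^ 10
      + 2 * modE ^ 12 := by
    rw [h3]
    simp only [map_add, theta_mul, theta_pow_succ, theta_modE, t2, t4]
    push_cast; grind
  have hr : expand 5 nat_five_ne_zero (X * jBar ^ 7 * jBar2 ^ 7) = (modE ^ 4 - 1) ^ 4 * gBar := by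
    rw [expand_five, ← X_mul_jBar_mul_jBar2, gBar]; ring
  rw [hL, theta_four_gBar, theta_three_gBar, theta_theta_gBar, theta_gBar, h4, h3, h2', ht, hr]
  grind

theorem coeff_sub_theta_four (f : (ZMod 5)⟦X⟧) (n : ℕ) :
    coeff (5 * n) (f - θ (θ (θ (θ f)))) = coeff (5 * n) f := by
  rw [map_sub, coeff_theta, Nat.cast_mul, show ((5 : ℕ) : ZMod 5) = 0 from rfl]; ring

theorem coeff_redFive_mul {S : ℤ⟦X⟧}
    (hS : eulerJ ^ 5 = expand 5 nat_five_ne_zero eulerJ * (1 - 5 * S)) (n : ℕ) :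
    coeff (5 * n + 4) (redFive (eulerJ ^ 3 * eulerJ2 ^ 3 * (2 * S - expand 2 two_ne_zero S))) =
      coeff n (jBar ^ 7 * jBar2 ^ 7) := by
  have hs := theta_redFive_of_eulerJ_pow_five hS
  have hs2 : θ (redFive (expand 2 two_ne_zero S)) = 2 * (logB - logB ^ 5) := by
    rw [redFive_expand, theta_E, hs, map_sub, map_pow, logB]
  have ht : θ (2 * redFive S - redFive (expand 2 two_ne_zero S)) =
      (modE ^ 3 - modE) ^ 5 - (modE ^ 3 - modE) := by
    rw [map_sub, theta_mul, theta_ofNat, hs, hs2, logA_eq, logB_eq]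
    grind
  -- The factor X in `gBar` turns exponent 5n+4 into 5(n+1), a multiple of 5, where θ⁴ contributes
  -- nothing.
  have key := congrArg (coeff (5 * (n + 1))) (sub_theta_four_gBar_mul ht)
  rw [coeff_sub_theta_four, coeff_expand_mul, mul_assoc X, coeff_succ_X_mul, gBar, mul_assoc X,
    mul_assoc X, mul_add_one, ← add_assoc (5 * n) 4 1, coeff_succ_X_mul] at key
  rw [← key]
  congr 1
  simp only [map_mul, map_pow, map_sub, map_ofNat, redFive_eulerJ2, jBar]

/-! ### Extraction of the exponents 5n+4. -/

section Decimation

variable {R : Type*} [CommRing R]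

/-- The series `∑ f_{5n+4} Xⁿ` attached to `∑ f_n Xⁿ`. -/
noncomputable def sectFour (f : R⟦X⟧) : R⟦X⟧ := mk fun n => coeff (5 * n + 4) f

@[simp] theorem coeff_sectFour (n : ℕ) (f : R⟦X⟧) :
    coeff n (sectFour f) = coeff (5 * n + 4) f := coeff_mk _ _

theorem sectFour_add (f g : R⟦X⟧) : sectFour (f + g) = sectFour f + sectFour g := by
  ext n; simp

theorem sectFour_C_mul (c : R) (f : R⟦X⟧) : sectFour (C c * f) = C c * sectFour f := by
  ext n; simp

theorem sectFour_mul_expand (f h : R⟦X⟧) :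
    sectFour (f * expand 5 nat_five_ne_zero h) = sectFour f * h := by
  ext n
  rw [coeff_sectFour, coeff_mul, coeff_mul]
  symm
  apply Finset.sum_of_injOn (fun p : ℕ × ℕ => (5 * p.1 + 4, 5 * p.2))
  · rintro ⟨a, b⟩ - ⟨c, d⟩ - h
    simp only [Prod.mk.injEq] at h ⊢
    omega
  · rintro ⟨a, b⟩ h
    simp only [SetLike.mem_coe, HasAntidiagonal.mem_antidiagonal] at h ⊢
    omega
  · rintro ⟨a, b⟩ h h'
    rw [HasAntidiagonal.mem_antidiagonal] at h
    dsimp only at h ⊢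
    rw [coeff_expand_of_not_dvd, mul_zero]
    rintro ⟨l, rfl⟩
    apply h'
    refine ⟨(n - l, l), ?_, ?_⟩
    · simp only [SetLike.mem_coe, HasAntidiagonal.mem_antidiagonal]; omega
    · simp only [Prod.mk.injEq, and_true]; omega
  · rintro ⟨a, b⟩ -
    rw [coeff_sectFour, coeff_expand_mul]

theorem map_sectFour {S : Type*} [CommRing S] (φ : R →+* S) (f : R⟦X⟧) :
    map φ (sectFour f) = sectFour (map φ f) := by
  ext n; simp

end Decimation

/-! ### The congruence modulo 25. -/

/-- With i and r in {0, 1, 3} mod 5, i + 2r ≡ 4 forces i ≡ r ≡ 3, and each of the two Jacobi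
coefficients then supplies a factor 5. -/
theorem twentyfive_dvd_coeff_cube_mul_cube (n : ℕ) :
    (25 : ℤ) ∣ coeff (5 * n + 4) (eulerJ ^ 3 * eulerJ2 ^ 3) := by
  have hE : eulerJ2 ^ 3 = expand 2 two_ne_zero (eulerJ ^ 3) := by rw [map_pow]; rfl
  rw [hE, coeff_mul]
  apply Finset.dvd_sum
  rintro ⟨i, l⟩ h
  rw [HasAntidiagonal.mem_antidiagonal] at h
  dsimp only at h ⊢
  by_cases hl : 2 ∣ l
  · obtain ⟨r, rfl⟩ := hl
    rw [coeff_expand_mul]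
    by_cases h1 : i % 5 = 2 ∨ i % 5 = 4
    · rw [coeff_eulerJ_cube_eq_zero h1]; simp
    by_cases h2 : r % 5 = 2 ∨ r % 5 = 4
    · rw [coeff_eulerJ_cube_eq_zero h2]; simp
    have h3 : r % 5 = 0 ∨ r % 5 = 1 ∨ r % 5 = 3 := by omega
    have hi : i % 5 = 3 := by rcases h3 with h3 | h3 | h3 <;> omega
    exact mul_dvd_mul (five_dvd_coeff_eulerJ_cube hi) (five_dvd_coeff_eulerJ_cube (by omega))
  · rw [coeff_expand_of_not_dvd _ _ _ hl]; simp

theorem sectFour_cube_mul_cube :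
    ∃ V : ℤ⟦X⟧, sectFour (eulerJ ^ 3 * eulerJ2 ^ 3) = 25 * V := by
  choose c hc using twentyfive_dvd_coeff_cube_mul_cube
  refine ⟨mk c, ?_⟩
  ext n
  have : (25 : ℤ⟦X⟧) = C (25 : ℤ) := by simp
  rw [this, coeff_C_mul, coeff_mk, coeff_sectFour, hc]

theorem exists_sectFour_eq :
    ∃ c : ℤ⟦X⟧, sectFour (eulerJ2 ^ 8 * iv eulerJ ^ 7) = 5 * c ∧
      redFive c = jBar ^ 5 * jBar2 ^ 8 := by
  obtain ⟨S, hS⟩ := exists_eulerJ_pow_five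
  obtain ⟨V, hV⟩ := sectFour_cube_mul_cube
  have hU := coeff_redFive_mul hS
  obtain ⟨S2, hS2d⟩ : ∃ S2, S2 = expand 2 two_ne_zero S := ⟨_, rfl⟩
  obtain ⟨F, hFd⟩ : ∃ F, F = eulerJ2 ^ 8 * iv eulerJ ^ 7 := ⟨_, rfl⟩
  obtain ⟨G, hGd⟩ : ∃ G, G = eulerJ ^ 3 * eulerJ2 ^ 3 := ⟨_, rfl⟩
  rw [← hFd]
  rw [← hS2d, ← hGd] at hU
  rw [← hGd] at hV
  have hiv : eulerJ * iv eulerJ = 1 := mul_iv (by simp)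
  have hF : F * eulerJ ^ 7 = eulerJ2 ^ 8 := by
    rw [hFd, mul_assoc, ← mul_pow, mul_comm (iv _), hiv]; simp
  have hS2 : eulerJ2 ^ 5 = expand 5 nat_five_ne_zero eulerJ2 * (1 - 5 * S2) := by
    have := congrArg (expand 2 two_ne_zero) hS
    simp only [map_mul, map_sub, map_pow, map_one, map_ofNat, ← hS2d] at this
    rw [eulerJ2, eulerJE, this, ← expand_mul, ← expand_mul]
  have h1 : F * expand 5 nat_five_ne_zero eulerJ ^ 2 * (1 - 5 * S) ^ 2 =
      expand 5 nat_five_ne_zero eulerJ2 * (1 - 5 * S2) * G := by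
    rw [mul_assoc, ← mul_pow, ← hS, ← hS2, hGd]
    linear_combination eulerJ ^ 3 * hF
  -- Since (1 - 5S)²(1 + 10S) = 1 - 25(3S² - 10S³), the factor 1 + 10S inverts (1 - 5S)² mod 25. `W`
  -- collects this remainder and that of (1 - 5S₂)(1 + 10S).
  obtain ⟨W, hW⟩ : ∃ W, W = F * expand 5 nat_five_ne_zero eulerJ ^ 2 * (3 * S ^ 2 - 10 * S ^ 3) -
      2 * G * expand 5 nat_five_ne_zero eulerJ2 * S * S2 := ⟨_, rfl⟩
  have h2 : F * expand 5 nat_five_ne_zero (eulerJ ^ 2) =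
      (G + C 5 * (G * (2 * S - S2))) * expand 5 nat_five_ne_zero eulerJ2 + C 25 * W := by
    rw [map_pow, hW]
    have h5 : (C 5 : ℤ⟦X⟧) = 5 := by simp
    have h25 : (C 25 : ℤ⟦X⟧) = 25 := by simp
    rw [h5, h25]
    linear_combination (1 + 10 * S) * h1
  have h3 := congrArg sectFour h2
  rw [sectFour_mul_expand, sectFour_add, sectFour_mul_expand, sectFour_C_mul, sectFour_add,
    sectFour_C_mul, hV] at h3
  have h5 : (C 5 : ℤ⟦X⟧) = 5 := by simp
  have h25 : (C 25 : ℤ⟦X⟧) = 25 := by simp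
  rw [h5, h25] at h3
  have hU' : redFive (sectFour (G * (2 * S - S2))) = jBar ^ 7 * jBar2 ^ 7 := by
    rw [map_sectFour]
    ext n
    rw [coeff_sectFour, hU]
  have h6 : (sectFour (G * (2 * S - S2)) * eulerJ2 + 5 * (V * eulerJ2 + sectFour W)) * iv eulerJ ^ 2
      * eulerJ ^ 2 =
      sectFour (G * (2 * S - S2)) * eulerJ2 + 5 * (V * eulerJ2 + sectFour W) := by
    rw [mul_assoc, ← mul_pow, mul_comm (iv _), hiv]; simp
  have hJ : eulerJ ≠ 0 := left_ne_zero_of_mul (hiv.trans_ne one_ne_zero)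
  refine ⟨(sectFour (G * (2 * S - S2)) * eulerJ2 + 5 * (V * eulerJ2 + sectFour W)) *
    iv eulerJ ^ 2, mul_right_cancel₀ (pow_ne_zero 2 hJ) ?_,
    mul_right_cancel₀ (pow_ne_zero 2 jBar_ne_zero) ?_⟩
  · rw [h3, mul_assoc 5, h6]; ring
  · rw [jBar, ← map_pow redFive eulerJ 2, ← map_mul, h6, map_add, map_mul, hU', map_mul redFive 5,
      map_ofNat, redFive_eulerJ2, map_pow, ← jBar, show (5 : (ZMod 5)⟦X⟧) = 0 by grind]
    ring

/-- Modulo 5 the fifth powers become series in q⁵, which leaves J₁³ at q²; its exponents are 2r with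
r ≡ 0, 1, hence 0 or 2 mod 5. -/
theorem coeff_pow_five_mul_pow_eight {m : ℕ} (hm : m % 5 = 1 ∨ m % 5 = 3 ∨ m % 5 = 4) :
    coeff m (jBar ^ 5 * jBar2 ^ 8) = 0 := by
  have h : jBar ^ 5 * jBar2 ^ 8 =
      expand 5 nat_five_ne_zero (jBar * jBar2) * expand 2 two_ne_zero (jBar ^ 3) := by
    rw [expand_five, map_pow, ← jBar2]; ring
  rw [h, coeff_mul]
  apply Finset.sum_eq_zero
  rintro ⟨i, l⟩ h
  rw [HasAntidiagonal.mem_antidiagonal] at h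
  dsimp only at h ⊢
  by_cases hi : 5 ∣ i
  swap
  · rw [coeff_expand_of_not_dvd _ _ _ hi, zero_mul]
  by_cases hl : 2 ∣ l
  swap
  · rw [coeff_expand_of_not_dvd _ _ _ hl, mul_zero]
  obtain ⟨r, rfl⟩ := hl
  rw [coeff_expand_mul, jBar, ← map_pow, coeff_map]
  by_cases h3 : r % 5 = 3
  · rw [eq_intCast, (ZMod.intCast_zmod_eq_zero_iff_dvd _ 5).2 (five_dvd_coeff_eulerJ_cube h3),
      mul_zero]
  · rw [coeff_eulerJ_cube_eq_zero (n := r) (by omega), map_zero, mul_zero]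

theorem twentyfive_dvd_phiCoeff {m : ℕ} (hm : m % 5 = 1 ∨ m % 5 = 3 ∨ m % 5 = 4) :
    (25 : ℤ) ∣ phiCoeff (10 * m + 9) := by
  obtain ⟨c, hc, hc'⟩ := exists_sectFour_eq
  have h : phiCoeff (10 * m + 9) = 5 * coeff m c := by
    rw [show 10 * m + 9 = 2 * (5 * m + 4) + 1 by ring, phiCoeff_two_mul_add_one, ← coeff_sectFour,
      hc, show (5 : ℤ⟦X⟧) = C (5 : ℤ) by simp, coeff_C_mul]
  rw [h]
  have h0 := coeff_pow_five_mul_pow_eight hm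
  rw [← hc', coeff_map, eq_intCast] at h0
  exact mul_dvd_mul_left 5 ((ZMod.intCast_zmod_eq_zero_iff_dvd _ 5).1 h0)

theorem corollary3p3 (n : ℕ) :
    phiCoeff (50 * n + 19) ≡ 0 [ZMOD 25] ∧
    phiCoeff (50 * n + 39) ≡ 0 [ZMOD 25] ∧
    phiCoeff (50 * n + 49) ≡ 0 [ZMOD 25] := by
  refine ⟨?_, ?_, ?_⟩ <;> rw [Int.modEq_zero_iff_dvd]
  · rw [show 50 * n + 19 = 10 * (5 * n + 1) + 9 by ring]
    exact twentyfive_dvd_phiCoeff (by omega)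
  · rw [show 50 * n + 39 = 10 * (5 * n + 3) + 9 by ring]
    exact twentyfive_dvd_phiCoeff (by omega)
  · rw [show 50 * n + 49 = 10 * (5 * n + 4) + 9 by ring]
    exact twentyfive_dvd_phiCoeff (by omega)
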